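/- **Setting.** Let $N,M\ge 1$ and consider a connected graph on $N$ agents with symmetric weighted adjacency matrix $A=[a_{k\ell}]$ (with $a_{k\ell}>0$ if $k$ and $\ell$ are joined by an edge and $a_{k\ell}=0$ otherwise), Laplacian $L=\mathrm{diag}\{\sum_\ell a_{k\ell}\}_{k}-A$ and $\mathcal L=L\otimes I_M$. Each agent $k$ has a twice differentiable cost $J_k:\mathbb R^M\to\mathbb R$ with $\lambda_{k,\min}I\le\nabla^2J_k(w)\le\lambda_{k,\max}I$ for all $w$, where $\lambda_{k,\min}>0$. Fix $\eta\ge 0$ and let $\mathcal W^o_\eta=\mathrm{col}\{w^o_{k,\eta}\}_{k=1}^N$ be the minimizer of $\sum_kJ_k(w_k)+\frac\eta2\mathcal W^\top\mathcal L\mathcal W$ over $\mathcal W=\mathrm{col}\{w_k\}_{k=1}^N$. Assume that for some $\kappa\ge0$, $\epsilon>0$: $\|\nabla^2J_k(w^o_{k,\eta}+\Delta)-\nabla^2J_k(w^o_{k,\eta})\|\le\kappa\|\Delta\|$ whenever $\|\Delta\|\le\epsilon$. For a step-size $\mu>0$ the algorithm is, for $i\ge1$, $$\psi_{k,i}=w_{k,i-1}-\mu\,\widehat{\nabla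 J_k}(w_{k,i-1}),\qquad w_{k,i}=\psi_{k,i}-\mu\eta\sum_{\ell}a_{k\ell}(\psi_{k,i}-\psi_{\ell,i}),$$ where $\widehat{\nabla J_k}=\widehat{\nabla J_k}_{,i}$ is a random approximation of $\nabla J_k$ at iteration $i$, and the initial state (which may depend on $\mu$) has finite fourth moment. Write $\mathcal W_i=\mathrm{col}\{w_{k,i}\}_{k=1}^N$, let $\mathcal F_i$ be the $\sigma$-algebra generated by $\mathcal W_0,\dots,\mathcal W_i$, and let $s_{k,i}(w)=\nabla J_k(w)-\widehat{\nabla J_k}_{,i}(w)$ be the gradient noise. Assume that, for all $\mu$ in some interval $(0,\mu_{\max})$, with constants that do not depend on $\mu$ and $i$, and for all $k$ and $i\ge1$: 1. $I_{MN}-\mu\eta\mathcal L$ has nonnegative entries and spectral radius one; 2. for every $\mathcal F_{i-1}$-measurable random vector $w$ (with finite second moment), $\mathbb E[s_{k,i}(w)\mid\mathcal F_{i-1}]=0$ and $\mathbb E[\|s_{k,i}(w)\|^2\mid\mathcal F_{i-1}]\le\beta_k^2\|w\|^2+\sigma_{s,k}^2$, where $s_{k,i}(w)$ has finite second moment; and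 the gradient noises of distinct agents are uncorrelated: $\mathbb E[s_{k,i}(w_{k,i-1})\,s_{\ell,i}(w_{\ell,i-1})^\top\mid\mathcal F_{i-1}]=0$ for $k\ne\ell$; 3. for every $\mathcal F_{i-1}$-measurable $w$ with finite fourth moment, $s_{k,i}(w)$ has finite fourth moment and $\mathbb E[\|s_{k,i}(w)\|^4\mid\mathcal F_{i-1}]\le\overline\beta_k^4\|w\|^4+\overline\sigma_{s,k}^4$; 4. with $R_{s,k,i}(w)=\mathbb E[s_{k,i}(w)s_{k,i}(w)^\top\mid\mathcal F_{i-1}]$, one has $\|R_{s,k,i}(w^o_{k,\eta}+\Delta)-R_{s,k,i}(w^o_{k,\eta})\|\le\kappa_d\|\Delta\|^\theta$ almost surely on $\{\|\Delta\|\le\epsilon_d\}$ for every $\mathcal F_{i-1}$-measurable random vector $\Delta$ with finite second moment, for some $\kappa_d\ge0$, $\epsilon_d>0$ and $0<\theta\le4$; 5. $R_{s,k,i}(w^o_{k,\eta})$ converges in probability, as $i\to\infty$, to a constant matrix $R_{s,k,\eta}$, which does not depend on $\mu$. **Definitions.** Let $\mathcal H_\eta=\mathrm{diag}\{\nabla^2J_k(w^o_{k,\eta})\}_{k=1}^N$,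 $\mathcal S_\eta=\mathrm{diag}\{R_{s,k,\eta}\}_{k=1}^N$, $$\mathcal B_\eta=(I-\mu\eta\mathcal L)(I-\mu\mathcal H_\eta),\quad \mathcal Y=\mu^2(I-\mu\eta\mathcal L)\mathcal S_\eta(I-\mu\eta\mathcal L),\quad \mathcal F_\eta=\mathcal B_\eta^\top\otimes_b\mathcal B_\eta^\top,\quad \theta_m=\tfrac12\min\{1,\theta\},$$ where $\otimes_b$ and $\mathrm{bvec}$ are the block Kronecker product and the block vectorization with blocks of size $M\times M$ ($\mathrm{bvec}$ stacks the vectorized blocks, block column after block column; the $M^2\times M^2$ block of $\mathcal C\otimes_b\mathcal D$ with row index $(k,m)$ and column index $(\ell,n)$ is $\mathcal C_{k\ell}\otimes\mathcal D_{mn}$). **Claim.** For all sufficiently small $\mu>0$ the iterates have finite second moments, bounded uniformly in $i$, the series below converges and $I-\mathcal F_\eta$ is invertible; and, as $\mu\to0^+$ (with $\eta$ fixed), $$\limsup_{i\to\infty}\frac1N\mathbb E\|\mathcal W^o_\eta-\mathcal W_i\|^2=\frac1N\sum_{n=0}^\infty\mathrm{Tr}\big(\mathcal B_\eta^n\,\mathcal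 Y\,(\mathcal B_\eta^\top)^n\big)+O(\mu^{1+\theta_m})$$ $$=\frac1N\big(\mathrm{bvec}(\mathcal Y^\top)\big)^\top(I-\mathcal F_\eta)^{-1}\mathrm{bvec}(I_{MN})+O(\mu^{1+\theta_m}).$$ -/

import Mathlib

open MeasureTheory Filter Topology Asymptotics
open scoped Kronecker

noncomputable section

/-- The parameter space of one agent, `ℝ^M` with the Euclidean norm. -/
abbrev Param (M : ℕ) : Type := EuclideanSpace ℝ (Fin M)

/-- Index set of the network vectors and of the `MN × MN` matrices: the pair `(k, a)` is entry `a`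
of block `k`. -/
abbrev NetIdx (N M : ℕ) : Type := Fin N × Fin M

/-! ### The network -/

/-- `A` is the symmetric, weighted adjacency matrix of a connected graph on `N` agents:
the edges are the pairs with `A k l > 0`, all other entries vanish. -/
structure IsNetwork {N : ℕ} (A : Matrix (Fin N) (Fin N) ℝ) : Prop where
  symm : A.IsSymm
  nonneg : ∀ k l, 0 ≤ A k l
  connected : (SimpleGraph.fromRel (fun k l : Fin N => 0 < A k l)).Connected

/-- The graph Laplacian `L = D - A`. -/
def laplacian {N : ℕ} (A : Matrix (Fin N) (Fin N) ℝ) : Matrix (Fin N) (Fin N) ℝ :=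
  Matrix.diagonal (fun k => ∑ l, A k l) - A

/-- The network Laplacian `L ⊗ I_M`. -/
def netLaplacian {N : ℕ} (M : ℕ) (A : Matrix (Fin N) (Fin N) ℝ) :
    Matrix (NetIdx N M) (NetIdx N M) ℝ :=
  laplacian A ⊗ₖ (1 : Matrix (Fin M) (Fin M) ℝ)

/-- The combination matrix `I - μ η (L ⊗ I_M)`. -/
def combination {N : ℕ} (M : ℕ) (A : Matrix (Fin N) (Fin N) ℝ) (η μ : ℝ) :
    Matrix (NetIdx N M) (NetIdx N M) ℝ :=
  1 - (μ * η) • netLaplacian M A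

/-- The (symmetric) combination matrix has nonnegative entries and its spectral radius is one. -/
structure CombinationCondition {N : ℕ} (M : ℕ) (A : Matrix (Fin N) (Fin N) ℝ) (η μ : ℝ) :
    Prop where
  nonneg : ∀ x y, 0 ≤ combination M A η μ x y
  spectralRadius_eq : spectralRadius ℝ (combination M A η μ) = 1

/-! ### Costs -/

/-- `col {w_1, …, w_N}`. -/
def col {N M : ℕ} (W : Fin N → Param M) : NetIdx N M → ℝ := fun x => W x.1 x.2

/-- The regularized cost `∑ J_k(w_k) + (η / 2) 𝒲ᵀ (L ⊗ I) 𝒲`. -/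
def globalCost {N M : ℕ} (A : Matrix (Fin N) (Fin N) ℝ) (J : Fin N → Param M → ℝ) (η : ℝ)
    (W : Fin N → Param M) : ℝ :=
  ∑ k, J k (W k) + η / 2 * (col W ⬝ᵥ (netLaplacian M A).mulVec (col W))

/-- The Hessian as an operator: the derivative of the gradient. -/
def hessian {M : ℕ} (f : Param M → ℝ) (w : Param M) : Param M →L[ℝ] Param M :=
  fderiv ℝ (gradient f) w

/-- The Hessian matrix. -/
def hessianMatrix {M : ℕ} (f : Param M → ℝ) (w : Param M) : Matrix (Fin M) (Fin M) ℝ :=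
  Matrix.of fun a b => hessian f w (EuclideanSpace.single b 1) a

/-- The cost is twice differentiable and `lmin I ≤ ∇² f ≤ lmax I` everywhere, with `lmin > 0`. -/
structure StronglyConvexCost {M : ℕ} (f : Param M → ℝ) (lmin lmax : ℝ) : Prop where
  pos : 0 < lmin
  differentiable : Differentiable ℝ f
  differentiable_gradient : Differentiable ℝ (gradient f)
  lower : ∀ w v : Param M, lmin * ‖v‖ ^ 2 ≤ inner ℝ v (hessian f w v)
  upper : ∀ w v : Param M, inner ℝ v (hessian f w v) ≤ lmax * ‖v‖ ^ 2

/-- The Hessian is Lipschitz continuous around the point `w`. -/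
def HessianLipschitzNear {M : ℕ} (f : Param M → ℝ) (w : Param M) (κ ε : ℝ) : Prop :=
  ∀ Δ : Param M, ‖Δ‖ ≤ ε → ‖hessian f (w + Δ) - hessian f w‖ ≤ κ * ‖Δ‖

/-! ### The stochastic algorithm -/

section Algorithm

variable {Ω : Type*} {N M : ℕ}

/-- The intermediate variables `ψ_k = w_k - μ ĝ_k(w_k)` for the gradient approximations `g k`. -/
def adaptStep (μ : ℝ) (g : Fin N → Param M → Param M) (W : Fin N → Param M) :
    Fin N → Param M :=
  fun k => W k - μ • g k (W k)

/-- The social step `w_k = ψ_k - μ η ∑_l a_{kl} (ψ_k - ψ_l)`. -/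
def combineStep (A : Matrix (Fin N) (Fin N) ℝ) (η μ : ℝ) (ψ : Fin N → Param M) :
    Fin N → Param M :=
  fun k => ψ k - (μ * η) • ∑ l, A k l • (ψ k - ψ l)

/-- The iterates of the multitask diffusion strategy. `g k i w` is the (random) approximation of
the gradient of the `k`-th cost at `w` at iteration `i`; `w₀` is the initial state. -/
def iterates (A : Matrix (Fin N) (Fin N) ℝ) (η μ : ℝ)
    (g : Fin N → ℕ → Param M → Ω → Param M) (w₀ : Ω → Fin N → Param M) :
    ℕ → Ω → Fin N → Param M
  | 0 => w₀
  | i + 1 => fun ω =>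
      combineStep A η μ (adaptStep μ (fun k w => g k (i + 1) w ω) (iterates A η μ g w₀ i ω))

/-- The gradient noise `s_{k,i}(w) = ∇J_k(w) - ĝ_{k,i}(w)`. -/
def gradNoise (J : Fin N → Param M → ℝ) (g : Fin N → ℕ → Param M → Ω → Param M)
    (k : Fin N) (i : ℕ) (w : Param M) (ω : Ω) : Param M :=
  gradient (J k) w - g k i w ω

/-- The σ-algebra generated by the process `W` up to and including time `i`. -/
@[reducible] def history (W : ℕ → Ω → Fin N → Param M) (i : ℕ) : MeasurableSpace Ω :=
  ⨆ (j : ℕ) (_ : j ≤ i), MeasurableSpace.comap (W j) inferInstance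

variable [MeasurableSpace Ω]

/-- First- and second-order conditions on the gradient noise `s`, relative to the history of the
process `W`. The noise at time `i + 1` is conditioned on the history up to time `i`. The first two
conditions are required at every random point that belongs to the history (and has the moment that
makes the conditional expectations meaningful); the noises of distinct agents are uncorrelated,
each being evaluated at the current iterate of its own agent. -/
structure NoiseSecondOrder (P : Measure Ω) (W : ℕ → Ω → Fin N → Param M)
    (s : Fin N → ℕ → Param M → Ω → Param M) (β σ : Fin N → ℝ) : Prop where
  memLp : ∀ (k : Fin N) (i : ℕ) (w : Ω → Param M), Measurable[history W i] w → MemLp w 2 P →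
    MemLp (fun ω => s k (i + 1) (w ω) ω) 2 P
  mean_zero : ∀ (k : Fin N) (i : ℕ) (w : Ω → Param M), Measurable[history W i] w → MemLp w 2 P →
    P[fun ω => s k (i + 1) (w ω) ω | history W i] =ᵐ[P] fun _ => 0
  second_moment : ∀ (k : Fin N) (i : ℕ) (w : Ω → Param M), Measurable[history W i] w →
    MemLp w 2 P →
    P[fun ω => ‖s k (i + 1) (w ω) ω‖ ^ 2 | history W i]
      ≤ᵐ[P] fun ω => β k ^ 2 * ‖w ω‖ ^ 2 + σ k ^ 2
  uncorrelated : ∀ (k l : Fin N) (i : ℕ), k ≠ l → ∀ a b : Fin M,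
    P[fun ω => s k (i + 1) (W i ω k) ω a * s l (i + 1) (W i ω l) ω b | history W i]
      =ᵐ[P] fun _ => 0

/-- Fourth-order condition on the gradient noise. -/
structure NoiseFourthOrder (P : Measure Ω) (W : ℕ → Ω → Fin N → Param M)
    (s : Fin N → ℕ → Param M → Ω → Param M) (β σ : Fin N → ℝ) : Prop where
  memLp : ∀ (k : Fin N) (i : ℕ) (w : Ω → Param M), Measurable[history W i] w → MemLp w 4 P →
    MemLp (fun ω => s k (i + 1) (w ω) ω) 4 P
  fourth_moment : ∀ (k : Fin N) (i : ℕ) (w : Ω → Param M), Measurable[history W i] w →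
    MemLp w 4 P →
    P[fun ω => ‖s k (i + 1) (w ω) ω‖ ^ 4 | history W i]
      ≤ᵐ[P] fun ω => β k ^ 4 * ‖w ω‖ ^ 4 + σ k ^ 4

/-- The conditional covariance `E[s_{k,i+1}(w) s_{k,i+1}(w)ᵀ | F_i]` at the random point `w`. -/
def condCov (P : Measure Ω) (W : ℕ → Ω → Fin N → Param M)
    (s : Fin N → ℕ → Param M → Ω → Param M) (k : Fin N) (i : ℕ) (w : Ω → Param M) (ω : Ω) :
    Matrix (Fin M) (Fin M) ℝ :=
  Matrix.of fun a b =>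
    (P[fun ω' => s k (i + 1) (w ω') ω' a * s k (i + 1) (w ω') ω' b | history W i]) ω

/-- The conditional noise covariance is locally Hölder continuous with exponent `θ` around `wo k`,
in the norm induced by the Euclidean norm. The perturbation is allowed to be random, as long as it
belongs to the history. -/
def NoiseCovSmooth (P : Measure Ω) (W : ℕ → Ω → Fin N → Param M)
    (s : Fin N → ℕ → Param M → Ω → Param M) (wo : Fin N → Param M) (κ ε θ : ℝ) : Prop :=
  ∀ (k : Fin N) (i : ℕ) (Δ : Ω → Param M), Measurable[history W i] Δ → MemLp Δ 2 P →
    ∀ᵐ ω ∂P, ‖Δ ω‖ ≤ ε →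
      ‖Matrix.toEuclideanCLM (𝕜 := ℝ)
          (condCov P W s k i (fun ω' => wo k + Δ ω') ω - condCov P W s k i (fun _ => wo k) ω)‖
        ≤ κ * ‖Δ ω‖ ^ θ

/-- The conditional noise covariance at `wo k` tends (in probability) to the constant `R k`. -/
def NoiseCovLimit (P : Measure Ω) (W : ℕ → Ω → Fin N → Param M)
    (s : Fin N → ℕ → Param M → Ω → Param M) (wo : Fin N → Param M)
    (R : Fin N → Matrix (Fin M) (Fin M) ℝ) : Prop :=
  ∀ (k : Fin N) (a b : Fin M),
    TendstoInMeasure P (fun i ω => condCov P W s k i (fun _ => wo k) ω a b) atTop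
      (fun _ => R k a b)

/-- `E ‖𝒲ᵒ - 𝒲_i‖²`. -/
def meanSquareError (P : Measure Ω) (wo : Fin N → Param M) (W : ℕ → Ω → Fin N → Param M)
    (i : ℕ) : ℝ :=
  ∫ ω, ∑ k, ‖wo k - W i ω k‖ ^ 2 ∂P

end Algorithm

/-! ### Block operations -/

section Block

variable {N M : ℕ}

/-- `diag {D_1, …, D_N}`. -/
def blockDiag (D : Fin N → Matrix (Fin M) (Fin M) ℝ) : Matrix (NetIdx N M) (NetIdx N M) ℝ :=
  Matrix.of fun x y => if x.1 = y.1 then D x.1 x.2 y.2 else 0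

/-- Index set of block vectorizations, in the order of stacking: block column, block row, column
inside the block, row inside the block. -/
abbrev BVecIdx (N M : ℕ) : Type := (Fin N × Fin N) × (Fin M × Fin M)

/-- Block vectorization with blocks of size `M × M`: the vectorized blocks are stacked, block column
after block column. -/
def bvec (C : Matrix (NetIdx N M) (NetIdx N M) ℝ) : BVecIdx N M → ℝ :=
  fun x => C (x.1.2, x.2.2) (x.1.1, x.2.1)

/-- Block Kronecker product with blocks of size `M × M`: the block with row index `(k, m)` and column
index `(l, n)` is the Kronecker product of the blocks `(k, l)` of `C` and `(m, n)` of `D`. -/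
def blockKron (C D : Matrix (NetIdx N M) (NetIdx N M) ℝ) :
    Matrix (BVecIdx N M) (BVecIdx N M) ℝ :=
  Matrix.of fun x y =>
    ((Matrix.of fun a b => C (x.1.1, a) (y.1.1, b)) ⊗ₖ
      (Matrix.of fun a b => D (x.1.2, a) (y.1.2, b))) x.2 y.2

/-- `ℬ_η = (I - μ η ℒ)(I - μ ℋ_η)`, with `ℋ_η = diag {∇²J_k(wo k)}`. -/
def matB (A : Matrix (Fin N) (Fin N) ℝ) (J : Fin N → Param M → ℝ) (wo : Fin N → Param M)
    (η μ : ℝ) : Matrix (NetIdx N M) (NetIdx N M) ℝ :=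
  combination M A η μ * (1 - μ • blockDiag (fun k => hessianMatrix (J k) (wo k)))

/-- `𝒴 = μ² (I - μ η ℒ) 𝒮_η (I - μ η ℒ)`, with `𝒮_η = diag {R_k}`. -/
def matY (A : Matrix (Fin N) (Fin N) ℝ) (R : Fin N → Matrix (Fin M) (Fin M) ℝ) (η μ : ℝ) :
    Matrix (NetIdx N M) (NetIdx N M) ℝ :=
  μ ^ 2 • (combination M A η μ * blockDiag R * combination M A η μ)

/-- `ℱ_η = ℬ_ηᵀ ⊗_b ℬ_ηᵀ`. -/
def matF (A : Matrix (Fin N) (Fin N) ℝ) (J : Fin N → Param M → ℝ) (wo : Fin N → Param M)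
    (η μ : ℝ) : Matrix (BVecIdx N M) (BVecIdx N M) ℝ :=
  blockKron (matB A J wo η μ).transpose (matB A J wo η μ).transpose

/-- The `n`-th term `Tr (ℬ_ηⁿ 𝒴 (ℬ_ηᵀ)ⁿ)`. -/
def traceTerm (A : Matrix (Fin N) (Fin N) ℝ) (J : Fin N → Param M → ℝ) (wo : Fin N → Param M)
    (R : Fin N → Matrix (Fin M) (Fin M) ℝ) (η μ : ℝ) (n : ℕ) : ℝ :=
  (matB A J wo η μ ^ n * matY A R η μ * (matB A J wo η μ).transpose ^ n).trace

/-- `(bvec (𝒴ᵀ))ᵀ (I - ℱ_η)⁻¹ bvec (I)`. -/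
def bvecForm (A : Matrix (Fin N) (Fin N) ℝ) (J : Fin N → Param M → ℝ) (wo : Fin N → Param M)
    (R : Fin N → Matrix (Fin M) (Fin M) ℝ) (η μ : ℝ) : ℝ :=
  bvec (matY A R η μ).transpose ⬝ᵥ
    (1 - matF A J wo η μ)⁻¹.mulVec (bvec (1 : Matrix (NetIdx N M) (NetIdx N M) ℝ))

end Block

end

/-!
Write `x_i` for the stacked error `wo - W_i`, `v_i` for the stacked gradient noise at the current
iterates, `C` for the combination matrix and `B = C (1 - μ ℋ)`. The algorithm is the recursion
`x_{i+1} = Φ(x_i) - μ C v_i`, where `Φ` is one noiseless step. Since `C` is doubly stochastic it does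
not increase the Euclidean norm, and a gradient step contracts by `1 - c μ`; as `wo` is stationary
for the regularized cost, it is a fixed point of the noiseless step up to a bias `O(μ²)`. Hence
`‖Φ x‖ ≤ (1 - c μ) ‖x‖ + O(μ²)`, and the Lipschitz condition on the Hessians gives
`‖Φ x - B x‖ ≤ O(μ) ‖x‖² + O(μ²)` for all `x`. These properties are collected in `ErrorRecursion`.

The noise is a martingale difference with fourth moments, and expanding `‖Φ x - μ C v‖⁴` gives
`E‖x_i‖⁴ = O(μ²)` for large `i`
(`ErrorRecursion.eventually_integral_pow_four_le`). Consequently the linear recursion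
`z_{i+1} = B z_i - μ C v_i` stays within `O(μ)` of `x_i` in mean square, and as both are of size
`O(√μ)`, `E‖x_i‖²` and `E‖z_i‖²` differ by `O(μ^{3/2})` (`ErrorRecursion.eventually_integral_sq_le`).
By orthogonality of the noises, `E‖z_i‖²` is the sum over `j < i` of
`μ² Tr(B^{i-1-j} C E[v_j v_jᵀ] C (Bᵀ)^{i-1-j})`. Replacing `E[v_j v_jᵀ]` by its limit `𝒮` costs
`O(μ)` times the error of the covariance (`ErrorRecursion.eventually_integral_sq_linearModel`). This
error is eventually `O(μ^{min(1, θ)/2})`: the conditional covariance at `wo` is bounded and tends to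
`𝒮` in probability, and Hölder continuity applies to perturbations of mean square `O(μ)`
(`NoiseSecondOrder.eventually_abs_integral_sub_le`). What remains is a partial sum of the series.

For the closed form, `bvec` turns the congruence `Z ↦ Bᵀ Z B` into multiplication by `ℱ`. Its
iterates tend to zero, so `1 - ℱ` is injective, and with `Z - Bᵀ Z B = 1` the series telescopes
(`bvecForm_eq_tsum`).
-/

noncomputable section

/-! ### Perturbed linear recursions of real numbers -/

/-- Only the eventual size of the perturbation matters; the factor `2` leaves room for the initial
value, whose influence decays. -/
theorem eventually_le_of_le_mul_add {q b : ℝ} (hq : 0 ≤ q) (hq1 : q < 1) (hb : 0 < b)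
    {u a : ℕ → ℝ} (hu : ∀ i, u (i + 1) ≤ q * u i + a i) (ha : ∀ᶠ i in atTop, a i ≤ b) :
    ∀ᶠ i in atTop, u i ≤ 2 * (b / (1 - q)) := by
  obtain ⟨n₀, hn₀⟩ := eventually_atTop.1 ha
  have hq' : 0 < 1 - q := by linarith
  have hbq : 0 < b / (1 - q) := div_pos hb hq'
  have hfix : q * (b / (1 - q)) + b = b / (1 - q) := by field_simp; ring
  have key : ∀ n, u (n + n₀) ≤ q ^ n * |u n₀| + b / (1 - q) := by
    intro n
    induction n with
    | zero =>
      rw [zero_add, pow_zero, one_mul]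
      exact (le_abs_self _).trans (by linarith)
    | succ n ih =>
      calc u (n + 1 + n₀) = u (n + n₀ + 1) := by congr 1; ring
        _ ≤ q * u (n + n₀) + a (n + n₀) := hu _
        _ ≤ q * (q ^ n * |u n₀| + b / (1 - q)) + b :=
          add_le_add (mul_le_mul_of_nonneg_left ih hq) (hn₀ _ (by omega))
        _ = q ^ (n + 1) * |u n₀| + (q * (b / (1 - q)) + b) := by ring
        _ = _ := by rw [hfix]
  have hlim : Tendsto (fun n : ℕ => q ^ n * |u n₀|) atTop (𝓝 0) := by
    simpa using (tendsto_pow_atTop_nhds_zero_of_lt_one hq hq1).mul_const |u n₀|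
  have hev : ∀ᶠ n in atTop, u (n + n₀) ≤ 2 * (b / (1 - q)) := by
    filter_upwards [hlim.eventually (gt_mem_nhds hbq)] with n hn
    linarith [key n]
  obtain ⟨n₁, hn₁⟩ := eventually_atTop.1 hev
  refine eventually_atTop.2 ⟨n₁ + n₀, fun i hi => ?_⟩
  have := hn₁ (i - n₀) (by omega)
  rwa [Nat.sub_add_cancel (by omega)] at this

/-! ### Pointwise inequalities -/

section Pointwise
variable {E : Type*} [NormedAddCommGroup E] [InnerProductSpace ℝ E]

/-- Convexity of the square, in the form in which it absorbs a small additive perturbation of a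
contraction: the perturbation is written as `t * y` with `t` the contraction rate. -/
theorem sq_le_of_le_convex {a x y t : ℝ} (ha : 0 ≤ a) (ht : 0 ≤ t) (ht1 : t ≤ 1)
    (h : a ≤ (1 - t) * x + t * y) : a ^ 2 ≤ (1 - t) * x ^ 2 + t * y ^ 2 := by
  have h1 : a ^ 2 ≤ ((1 - t) * x + t * y) ^ 2 := pow_le_pow_left₀ ha h 2
  have h2 : 0 ≤ t * (1 - t) * (x - y) ^ 2 := by
    have : 0 ≤ 1 - t := by linarith
    positivity
  nlinarith

theorem pow_four_le_of_le_convex {a x y t : ℝ} (ha : 0 ≤ a) (ht : 0 ≤ t) (ht1 : t ≤ 1)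
    (h : a ≤ (1 - t) * x + t * y) : a ^ 4 ≤ (1 - t) * x ^ 4 + t * y ^ 4 := by
  have := sq_le_of_le_convex (sq_nonneg a) ht ht1 (sq_le_of_le_convex ha ht ht1 h)
  calc a ^ 4 = (a ^ 2) ^ 2 := by ring
    _ ≤ _ := this
    _ = _ := by ring

/-- Fourth power of a difference, with the term that is odd in `u` to first order kept exactly and
all others estimated; `d` is free, for absorbing part of the mixed term into `‖y‖ ^ 4`. -/
theorem norm_sub_pow_four_le (y u : E) {d : ℝ} (hd : 0 < d) :
    ‖y - u‖ ^ 4 ≤ (1 + d) * ‖y‖ ^ 4 - 4 * inner ℝ (‖y‖ ^ 2 • y) u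
      + (16 / d + 3) * ‖u‖ ^ 4 := by
  have h0 : ‖y - u‖ ^ 2 = ‖y‖ ^ 2 - 2 * inner ℝ y u + ‖u‖ ^ 2 := norm_sub_sq_real y u
  have h1 : (inner ℝ y u) ^ 2 ≤ ‖y‖ ^ 2 * ‖u‖ ^ 2 := by
    rw [← mul_pow, ← sq_abs]
    exact pow_le_pow_left₀ (abs_nonneg _) (abs_real_inner_le_norm y u) 2
  have h2 : 8 * (‖y‖ ^ 2 * ‖u‖ ^ 2) ≤ d * ‖y‖ ^ 4 + 16 / d * ‖u‖ ^ 4 := by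
    have : 0 ≤ (d * ‖y‖ ^ 2 - 4 * ‖u‖ ^ 2) ^ 2 / d := by positivity
    have e : (d * ‖y‖ ^ 2 - 4 * ‖u‖ ^ 2) ^ 2 / d
        = d * ‖y‖ ^ 4 + 16 / d * ‖u‖ ^ 4 - 8 * (‖y‖ ^ 2 * ‖u‖ ^ 2) := by
      field_simp; ring
    linarith
  rw [real_inner_smul_left]
  have e4 : ‖y - u‖ ^ 4 = (‖y‖ ^ 2 - 2 * inner ℝ y u + ‖u‖ ^ 2) ^ 2 := by rw [← h0]; ring
  rw [e4]
  nlinarith [sq_nonneg (inner ℝ y u + ‖u‖ ^ 2)]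

/-- How much the squared norm of `x` differs from that of a nearby point `z`. -/
theorem abs_norm_sq_sub_norm_sq_le (x z : E) {r : ℝ} (hr : 0 < r) :
    |‖x‖ ^ 2 - ‖z‖ ^ 2| ≤ r * ‖x‖ ^ 2 + (1 / r + 1) * ‖x - z‖ ^ 2 := by
  have h0 : ‖z‖ ^ 2 = ‖x‖ ^ 2 - 2 * inner ℝ x (x - z) + ‖x - z‖ ^ 2 := by
    rw [← norm_sub_sq_real, sub_sub_cancel]
  have h1 := abs_real_inner_le_norm x (x - z)
  have h2 : 2 * (‖x‖ * ‖x - z‖) ≤ r * ‖x‖ ^ 2 + 1 / r * ‖x - z‖ ^ 2 := by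
    have : 0 ≤ (r * ‖x‖ - ‖x - z‖) ^ 2 / r := by positivity
    have e : (r * ‖x‖ - ‖x - z‖) ^ 2 / r
        = r * ‖x‖ ^ 2 + 1 / r * ‖x - z‖ ^ 2 - 2 * (‖x‖ * ‖x - z‖) := by
      field_simp; ring
    linarith
  rw [abs_le] at h1 ⊢
  constructor <;> nlinarith [sq_nonneg ‖x - z‖]

end Pointwise

/-! ### Martingale differences -/

section Martingale
variable {Ω : Type*} [mΩ : MeasurableSpace Ω] {P : Measure Ω}
  {E : Type*} [NormedAddCommGroup E] [InnerProductSpace ℝ E] [CompleteSpace E]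

theorem integral_inner_eq_zero_of_condExp_eq_zero [IsProbabilityMeasure P]
    {m : MeasurableSpace Ω} (hm : m ≤ mΩ)
    {U V : Ω → E} (hU : StronglyMeasurable[m] U) (hV : Integrable V P)
    (hUV : Integrable (fun ω => inner ℝ (U ω) (V ω)) P) (h0 : P[V | m] =ᵐ[P] fun _ => 0) :
    ∫ ω, inner ℝ (U ω) (V ω) ∂P = 0 := by
  have h := condExp_bilin_of_stronglyMeasurable_left (μ := P) (m := m) (innerSL ℝ (E := E)) hU
    hUV hV
  rw [← integral_condExp hm]
  refine integral_eq_zero_of_ae ?_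
  have h' : P[fun ω => inner ℝ (U ω) (V ω) | m] =ᵐ[P] fun ω => inner ℝ (U ω) (P[V | m] ω) := h
  filter_upwards [h', h0] with ω h1 h2
  rw [h1, h2]; simp

theorem integral_condExp_eq_zero [IsProbabilityMeasure P] {m : MeasurableSpace Ω} (hm : m ≤ mΩ)
    {f : Ω → ℝ} (h0 : P[f | m] =ᵐ[P] fun _ => 0) : ∫ ω, f ω ∂P = 0 := by
  rw [← integral_condExp hm]
  exact integral_eq_zero_of_ae h0

end Martingale

/-! ### A contractive recursion driven by martingale differences -/

section Recursion
variable {Ω : Type*} [mΩ : MeasurableSpace Ω] {P : Measure Ω}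
  {ι : Type*} [Fintype ι]

/-- The recursion `X (i + 1) = Φ (X i) - μ C (V i)` of an error process `X` adapted to the
filtration `m`, with noise `V i` that has conditional mean zero given `m i`. The step `Φ` contracts
up to a bias of size `μ²`, and `B` is its linear approximation at the origin. The rate `c`, the bias
`b` and the constant `K` are meant to be the same for all step-sizes `μ`. -/
structure ErrorRecursion (P : Measure Ω) (m : ℕ → MeasurableSpace Ω)
    (X V : ℕ → Ω → EuclideanSpace ℝ ι) (Φ : EuclideanSpace ℝ ι → EuclideanSpace ℝ ι)
    (B C : EuclideanSpace ℝ ι →L[ℝ] EuclideanSpace ℝ ι) (μ c b K : ℝ) : Prop where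
  le : ∀ i, m i ≤ mΩ
  mono : Monotone m
  adapted : ∀ i, Measurable[m i] (X i)
  memLp_error : ∀ i, MemLp (X i) 4 P
  memLp_noise : ∀ i, MemLp (V i) 4 P
  noise_mean : ∀ i, P[V i | m i] =ᵐ[P] fun _ => 0
  noise_fourth : ∀ i, ∫ ω, ‖V i ω‖ ^ 4 ∂P ≤ K * (1 + ∫ ω, ‖X i ω‖ ^ 4 ∂P)
  step : ∀ i ω, X (i + 1) ω = Φ (X i ω) - μ • C (V i ω)
  continuous : Continuous Φ
  norm_comb : ‖C‖ ≤ 1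
  norm_linear : ‖B‖ ≤ 1 - c * μ
  contract : ∀ x, ‖Φ x‖ ≤ (1 - c * μ) * ‖x‖ + μ ^ 2 * b
  linearize : ∀ x, ‖Φ x - B x‖ ≤ μ * (K * ‖x‖ ^ 2) + μ ^ 2 * b

/-- The linear recursion `Z (i + 1) = B (Z i) - μ C (V i)` with the same noise, started at zero. -/
def linearModel (B C : EuclideanSpace ℝ ι →L[ℝ] EuclideanSpace ℝ ι) (μ : ℝ)
    (V : ℕ → Ω → EuclideanSpace ℝ ι) : ℕ → Ω → EuclideanSpace ℝ ι
  | 0 => fun _ => 0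
  | i + 1 => fun ω => B (linearModel B C μ V i ω) - μ • C (V i ω)

theorem integrable_norm_pow_four {E : Type*} [NormedAddCommGroup E] {f : Ω → E}
    (hf : MemLp f 4 P) : Integrable (fun ω => ‖f ω‖ ^ 4) P := by
  have := MemLp.integrable_norm_pow (p := 4) (f := f) (μ := P) (by exact_mod_cast hf) (by norm_num)
  exact this

theorem integrable_norm_sq {E : Type*} [NormedAddCommGroup E] {f : Ω → E}
    (hf : MemLp f 2 P) : Integrable (fun ω => ‖f ω‖ ^ 2) P := by
  have := MemLp.integrable_norm_pow (p := 2) (f := f) (μ := P) (by exact_mod_cast hf) (by norm_num)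
  exact this

theorem MeasureTheory.MemLp.two_of_four [IsProbabilityMeasure P] {E : Type*}
    [NormedAddCommGroup E] {f : Ω → E}
    (hf : MemLp f 4 P) : MemLp f 2 P :=
  hf.mono_exponent (by norm_num)

theorem integrable_inner_of_memLp_two {E : Type*} [NormedAddCommGroup E] [InnerProductSpace ℝ E]
    {f g : Ω → E} (hf : MemLp f 2 P) (hg : MemLp g 2 P) :
    Integrable (fun ω => inner ℝ (f ω) (g ω)) P := by
  refine ((integrable_norm_sq hf).add (integrable_norm_sq hg)).mono'
    (hf.1.inner hg.1) (ae_of_all _ fun ω => ?_)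
  have := abs_real_inner_le_norm (f ω) (g ω)
  simp only [Real.norm_eq_abs, Pi.add_apply]
  nlinarith [sq_nonneg (‖f ω‖ - ‖g ω‖), sq_nonneg ‖f ω‖, sq_nonneg ‖g ω‖]

theorem integrable_inner_sq_smul_of_memLp_four {E : Type*} [NormedAddCommGroup E]
    [InnerProductSpace ℝ E] {f g : Ω → E} (hf : MemLp f 4 P) (hg : MemLp g 4 P) :
    Integrable (fun ω => inner ℝ (‖f ω‖ ^ 2 • f ω) (g ω)) P := by
  refine ((integrable_norm_pow_four hf).add (integrable_norm_pow_four hg)).mono'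
    (((hf.1.norm.pow 2).smul hf.1).inner hg.1) (ae_of_all _ fun ω => ?_)
  have h := abs_real_inner_le_norm (‖f ω‖ ^ 2 • f ω) (g ω)
  rw [norm_smul, norm_pow, norm_norm] at h
  simp only [Real.norm_eq_abs, Pi.add_apply]
  refine h.trans ?_
  have h3 : ‖f ω‖ ^ 3 * ‖g ω‖ ≤ ‖f ω‖ ^ 4 + ‖g ω‖ ^ 4 := by
    rcases le_total ‖f ω‖ ‖g ω‖ with h | h
    · calc ‖f ω‖ ^ 3 * ‖g ω‖ ≤ ‖g ω‖ ^ 3 * ‖g ω‖ := by gcongr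
        _ = ‖g ω‖ ^ 4 := by ring
        _ ≤ _ := le_add_of_nonneg_left (by positivity)
    · calc ‖f ω‖ ^ 3 * ‖g ω‖ ≤ ‖f ω‖ ^ 3 * ‖f ω‖ := by gcongr
        _ = ‖f ω‖ ^ 4 := by ring
        _ ≤ _ := le_add_of_nonneg_right (by positivity)
  calc _ = ‖f ω‖ ^ 3 * ‖g ω‖ := by ring
    _ ≤ _ := h3

/-- The fourth moment controls the second one, with a weight that suits a fourth moment of
order `μ²`. -/
theorem integral_norm_sq_le_of_pow_four [IsProbabilityMeasure P] {E : Type*}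
    [NormedAddCommGroup E] {f : Ω → E}
    (hf : MemLp f 4 P) {r : ℝ} (hr : 0 < r) :
    ∫ ω, ‖f ω‖ ^ 2 ∂P ≤ r + (∫ ω, ‖f ω‖ ^ 4 ∂P) / r := by
  calc ∫ ω, ‖f ω‖ ^ 2 ∂P ≤ ∫ ω, (r + ‖f ω‖ ^ 4 / r) ∂P := by
        refine integral_mono (integrable_norm_sq hf.two_of_four)
          ((integrable_const _).add ((integrable_norm_pow_four hf).div_const r)) fun ω => ?_
        have h : r + ‖f ω‖ ^ 4 / r - ‖f ω‖ ^ 2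
            = ((r - ‖f ω‖ ^ 2) ^ 2 + r * ‖f ω‖ ^ 2) / r := by field_simp; ring
        have : 0 ≤ ((r - ‖f ω‖ ^ 2) ^ 2 + r * ‖f ω‖ ^ 2) / r := by positivity
        dsimp only; linarith
    _ = _ := by
        rw [integral_add (integrable_const _) ((integrable_norm_pow_four hf).div_const r),
          integral_div]
        simp

namespace ErrorRecursion

variable {m : ℕ → MeasurableSpace Ω} {X V : ℕ → Ω → EuclideanSpace ℝ ι}
  {Φ : EuclideanSpace ℝ ι → EuclideanSpace ℝ ι}
  {B C : EuclideanSpace ℝ ι →L[ℝ] EuclideanSpace ℝ ι} {μ c b K : ℝ}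

theorem mul_le_one (h : ErrorRecursion P m X V Φ B C μ c b K) : c * μ ≤ 1 := by
  linarith [norm_nonneg B, h.norm_linear]

theorem memLp_drift (h : ErrorRecursion P m X V Φ B C μ c b K) (i : ℕ) :
    MemLp (fun ω => Φ (X i ω)) 4 P := by
  have e : (fun ω => Φ (X i ω)) = fun ω => X (i + 1) ω + μ • C (V i ω) := by
    funext ω; rw [h.step, sub_add_cancel]
  rw [e]
  exact (h.memLp_error (i + 1)).add ((C.comp_memLp' (h.memLp_noise i)).const_smul μ)

theorem measurable_drift (h : ErrorRecursion P m X V Φ B C μ c b K) (i : ℕ) :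
    Measurable[m i] (fun ω => Φ (X i ω)) :=
  h.continuous.measurable.comp (h.adapted i)

/-- Linear images of the noise are orthogonal to the past. -/
theorem integral_inner_noise [IsProbabilityMeasure P]
    (h : ErrorRecursion P m X V Φ B C μ c b K) (i : ℕ)
    {U : Ω → EuclideanSpace ℝ ι} (hU : Measurable[m i] U)
    (A : EuclideanSpace ℝ ι →L[ℝ] EuclideanSpace ℝ ι)
    (hUV : Integrable (fun ω => inner ℝ (U ω) (A (V i ω))) P) :
    ∫ ω, inner ℝ (U ω) (A (V i ω)) ∂P = 0 := by
  have hVi : Integrable (V i) P := (h.memLp_noise i).integrable (by norm_num)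
  refine integral_inner_eq_zero_of_condExp_eq_zero (h.le i) hU.stronglyMeasurable
    (A.integrable_comp hVi) hUV ?_
  refine (A.comp_condExp_comm hVi).symm.trans ?_
  filter_upwards [h.noise_mean i] with ω hω
  simp [hω]

/-- One step of the fourth moment. The term that is linear in the noise has mean zero, and half of
the contraction rate is spent on the mixed quadratic term, so that the noise enters at order `μ³`. -/
theorem integral_pow_four_succ_le [IsProbabilityMeasure P]
    (h : ErrorRecursion P m X V Φ B C μ c b K)
    (hμ : 0 < μ) (hμ1 : μ ≤ 1) (hc : 0 < c) (i : ℕ) :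
    ∫ ω, ‖X (i + 1) ω‖ ^ 4 ∂P ≤ (1 - c * μ / 2 + (32 / c + 3) * K * μ ^ 3)
      * ∫ ω, ‖X i ω‖ ^ 4 ∂P + (2 * b ^ 4 / c ^ 3 + (32 / c + 3) * K) * μ ^ 3 := by
  have hcμ := h.mul_le_one
  have hcμ0 : 0 < c * μ := mul_pos hc hμ
  have hy := h.memLp_drift i
  have hu : MemLp (fun ω => μ • C (V i ω)) 4 P :=
    (C.comp_memLp' (h.memLp_noise i)).const_smul μ
  have iy := integrable_norm_pow_four hy
  have iu := integrable_norm_pow_four hu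
  have iX := integrable_norm_pow_four (h.memLp_error i)
  have iV := integrable_norm_pow_four (h.memLp_noise i)
  have iyu := integrable_inner_sq_smul_of_memLp_four hy hu
  have hzero : ∫ ω, inner ℝ (‖Φ (X i ω)‖ ^ 2 • Φ (X i ω)) (μ • C (V i ω)) ∂P = 0 :=
    h.integral_inner_noise i (((h.continuous.norm.pow 2).smul h.continuous).measurable.comp
      (h.adapted i)) (μ • C) iyu
  have hd : 0 < c * μ / 2 := by positivity
  have i1 : Integrable (fun ω => (1 + c * μ / 2) * ‖Φ (X i ω)‖ ^ 4
      - 4 * inner ℝ (‖Φ (X i ω)‖ ^ 2 • Φ (X i ω)) (μ • C (V i ω))) P :=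
    (iy.const_mul _).sub (iyu.const_mul _)
  have s1 : ∫ ω, ‖X (i + 1) ω‖ ^ 4 ∂P ≤ (1 + c * μ / 2) * ∫ ω, ‖Φ (X i ω)‖ ^ 4 ∂P
      + (16 / (c * μ / 2) + 3) * ∫ ω, ‖μ • C (V i ω)‖ ^ 4 ∂P := by
    calc ∫ ω, ‖X (i + 1) ω‖ ^ 4 ∂P
        ≤ ∫ ω, ((1 + c * μ / 2) * ‖Φ (X i ω)‖ ^ 4
            - 4 * inner ℝ (‖Φ (X i ω)‖ ^ 2 • Φ (X i ω)) (μ • C (V i ω))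
            + (16 / (c * μ / 2) + 3) * ‖μ • C (V i ω)‖ ^ 4) ∂P := by
          refine integral_mono (integrable_norm_pow_four (h.memLp_error _))
            (i1.add (iu.const_mul _)) fun ω => ?_
          dsimp only
          rw [h.step]
          exact norm_sub_pow_four_le _ _ hd
      _ = _ := by
          rw [integral_add i1 (iu.const_mul _),
            integral_sub (iy.const_mul _) (iyu.const_mul _), integral_const_mul,
            integral_const_mul, integral_const_mul, hzero]
          ring
  have s2 : ∫ ω, ‖Φ (X i ω)‖ ^ 4 ∂P
      ≤ (1 - c * μ) * ∫ ω, ‖X i ω‖ ^ 4 ∂P + c * μ * (μ * b / c) ^ 4 := by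
    calc ∫ ω, ‖Φ (X i ω)‖ ^ 4 ∂P
        ≤ ∫ ω, ((1 - c * μ) * ‖X i ω‖ ^ 4 + c * μ * (μ * b / c) ^ 4) ∂P := by
          refine integral_mono iy ((iX.const_mul _).add (integrable_const _)) fun ω => ?_
          refine pow_four_le_of_le_convex (norm_nonneg _) hcμ0.le hcμ ?_
          refine (h.contract _).trans (le_of_eq ?_)
          field_simp
      _ = _ := by
          rw [integral_add (iX.const_mul _) (integrable_const _), integral_const_mul]
          simp
  have s3 : ∫ ω, ‖μ • C (V i ω)‖ ^ 4 ∂P ≤ μ ^ 4 * (K * (1 + ∫ ω, ‖X i ω‖ ^ 4 ∂P)) := by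
    refine le_trans ?_ (mul_le_mul_of_nonneg_left (h.noise_fourth i) (by positivity))
    rw [← integral_const_mul]
    refine integral_mono iu (iV.const_mul _) fun ω => ?_
    dsimp only
    rw [norm_smul, mul_pow, Real.norm_of_nonneg hμ.le]
    have : ‖C (V i ω)‖ ≤ ‖V i ω‖ := by
      simpa using C.le_of_opNorm_le h.norm_comb (V i ω)
    gcongr
  set a := ∫ ω, ‖X i ω‖ ^ 4 ∂P with ha
  have ha0 : 0 ≤ a := integral_nonneg fun ω => by positivity
  have hK : 0 ≤ K * (1 + a) :=
    (integral_nonneg fun ω => by positivity).trans (h.noise_fourth i)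
  have e1 : (16 / (c * μ / 2) + 3) * (μ ^ 4 * (K * (1 + a)))
      ≤ (32 / c + 3) * μ ^ 3 * (K * (1 + a)) := by
    rw [← mul_assoc]
    refine mul_le_mul_of_nonneg_right ?_ hK
    have : (16 / (c * μ / 2) + 3) * μ ^ 4 = 32 / c * μ ^ 3 + 3 * μ ^ 3 * μ := by
      field_simp; ring
    rw [this]
    nlinarith [pow_pos hμ 3]
  have e2 : (1 + c * μ / 2) * ((1 - c * μ) * a + c * μ * (μ * b / c) ^ 4)
      ≤ (1 - c * μ / 2) * a + 2 * b ^ 4 / c ^ 3 * μ ^ 3 := by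
    have e3 : (1 + c * μ / 2) * (c * μ * (μ * b / c) ^ 4) ≤ 2 * b ^ 4 / c ^ 3 * μ ^ 3 := by
      have : c * μ * (μ * b / c) ^ 4 = b ^ 4 / c ^ 3 * μ ^ 3 * μ ^ 2 := by field_simp
      rw [this]
      have hp : 0 ≤ b ^ 4 / c ^ 3 * μ ^ 3 := by positivity
      have hq : (1 + c * μ / 2) * μ ^ 2 ≤ 2 := by
        have : μ ^ 2 ≤ 1 := pow_le_one₀ hμ.le hμ1
        nlinarith [sq_nonneg μ]
      calc _ = (b ^ 4 / c ^ 3 * μ ^ 3) * ((1 + c * μ / 2) * μ ^ 2) := by ring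
        _ ≤ (b ^ 4 / c ^ 3 * μ ^ 3) * 2 := mul_le_mul_of_nonneg_left hq hp
        _ = _ := by ring
    nlinarith [mul_nonneg (sq_nonneg (c * μ)) ha0]
  have t1 := mul_le_mul_of_nonneg_left s2 (by positivity : 0 ≤ 1 + c * μ / 2)
  have t2 := mul_le_mul_of_nonneg_left s3 (by positivity : 0 ≤ 16 / (c * μ / 2) + 3)
  calc _ ≤ _ := s1
    _ ≤ ((1 - c * μ / 2) * a + 2 * b ^ 4 / c ^ 3 * μ ^ 3)
        + (32 / c + 3) * μ ^ 3 * (K * (1 + a)) := add_le_add (t1.trans e2) (t2.trans e1)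
    _ = _ := by ring

/-- The fourth moment of the error is eventually of order `μ²`. -/
theorem eventually_integral_pow_four_le [IsProbabilityMeasure P] {c b K : ℝ} (hc : 0 < c)
    (hK : 0 ≤ K) :
    ∃ K₁ > 0, ∃ μ₁ > 0, ∀ (μ : ℝ) (m : ℕ → MeasurableSpace Ω)
      (X V : ℕ → Ω → EuclideanSpace ℝ ι) (Φ : EuclideanSpace ℝ ι → EuclideanSpace ℝ ι)
      (B C : EuclideanSpace ℝ ι →L[ℝ] EuclideanSpace ℝ ι), 0 < μ → μ < μ₁ →
      ErrorRecursion P m X V Φ B C μ c b K →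
      ∀ᶠ i in atTop, ∫ ω, ‖X i ω‖ ^ 4 ∂P ≤ K₁ * μ ^ 2 := by
  set L := (32 / c + 3) * K with hL
  have hL0 : 0 ≤ L := by positivity
  refine ⟨8 * (2 * b ^ 4 / c ^ 3 + L + 1) / c, by positivity, min 1 (c / (4 * (L + 1))),
    by positivity, ?_⟩
  intro μ m X V Φ B C hμ hμ1 h
  have hμ1' : μ ≤ 1 := hμ1.le.trans (min_le_left _ _)
  have hμ2 : μ * (4 * (L + 1)) ≤ c := by
    have := hμ1.le.trans (min_le_right _ _)
    rwa [le_div_iff₀ (by positivity)] at this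
  have hcμ := h.mul_le_one
  have hcμ0 : 0 < c * μ := mul_pos hc hμ
  have hq : L * μ ^ 3 ≤ c * μ / 4 := by
    have h1 : L * μ ^ 2 ≤ c / 4 := by nlinarith [mul_nonneg hL0 hμ.le]
    calc L * μ ^ 3 = L * μ ^ 2 * μ := by ring
      _ ≤ c / 4 * μ := by gcongr
      _ = _ := by ring
  have hrec : ∀ i, ∫ ω, ‖X (i + 1) ω‖ ^ 4 ∂P ≤ (1 - c * μ / 4) * ∫ ω, ‖X i ω‖ ^ 4 ∂P
      + (2 * b ^ 4 / c ^ 3 + L + 1) * μ ^ 3 := by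
    intro i
    have ha0 : 0 ≤ ∫ ω, ‖X i ω‖ ^ 4 ∂P := integral_nonneg fun ω => by positivity
    have := h.integral_pow_four_succ_le hμ hμ1' hc i
    have h3 : 0 < μ ^ 3 := by positivity
    nlinarith [mul_le_mul_of_nonneg_right hq ha0]
  have := eventually_le_of_le_mul_add (q := 1 - c * μ / 4)
    (u := fun i => ∫ ω, ‖X i ω‖ ^ 4 ∂P)
    (b := (2 * b ^ 4 / c ^ 3 + L + 1) * μ ^ 3) (by linarith) (by linarith) (by positivity)
    hrec (Eventually.of_forall fun _ => le_rfl)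
  filter_upwards [this] with i hi
  refine hi.trans (le_of_eq ?_)
  field_simp
  ring

end ErrorRecursion
end Recursion

section Recursion
variable {Ω : Type*} [mΩ : MeasurableSpace Ω] {P : Measure Ω}
  {ι : Type*} [Fintype ι]

namespace ErrorRecursion

variable {m : ℕ → MeasurableSpace Ω} {X V : ℕ → Ω → EuclideanSpace ℝ ι}
  {Φ : EuclideanSpace ℝ ι → EuclideanSpace ℝ ι}
  {B C : EuclideanSpace ℝ ι →L[ℝ] EuclideanSpace ℝ ι} {μ c b K : ℝ}

/-! ### Comparison with the linear recursion -/

theorem memLp_linearModel (h : ErrorRecursion P m X V Φ B C μ c b K) (i : ℕ) :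
    MemLp (linearModel B C μ V i) 4 P := by
  induction i with
  | zero => exact MemLp.zero'
  | succ i ih => exact (B.comp_memLp' ih).sub ((C.comp_memLp' (h.memLp_noise i)).const_smul μ)

theorem measurable_linearModel (h : ErrorRecursion P m X V Φ B C μ c b K) (i : ℕ) :
    Measurable[m i] (linearModel B C μ V i) := by
  induction i with
  | zero => exact measurable_const
  | succ i ih =>
    -- The noise itself need not be adapted, only the part `μ C (V i)` that enters the recursion.
    have e : linearModel B C μ V (i + 1)
        = fun ω => B (linearModel B C μ V i ω) - Φ (X i ω) + X (i + 1) ω := by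
      funext ω
      rw [h.step]
      change B (linearModel B C μ V i ω) - μ • C (V i ω) = _
      abel
    rw [e]
    have hm : m i ≤ m (i + 1) := h.mono (Nat.le_succ i)
    have h1 : Measurable[m (i + 1)] fun ω => B (linearModel B C μ V i ω) :=
      B.measurable.comp (ih.mono hm le_rfl)
    have h2 : Measurable[m (i + 1)] fun ω => Φ (X i ω) := (h.measurable_drift i).mono hm le_rfl
    exact (h1.sub h2).add (h.adapted (i + 1))

theorem integral_sq_sub_linearModel_succ_le [IsProbabilityMeasure P]
    (h : ErrorRecursion P m X V Φ B C μ c b K) (hμ : 0 < μ) (hc : 0 < c) (i : ℕ) :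
    ∫ ω, ‖X (i + 1) ω - linearModel B C μ V (i + 1) ω‖ ^ 2 ∂P
      ≤ (1 - c * μ) * ∫ ω, ‖X i ω - linearModel B C μ V i ω‖ ^ 2 ∂P
        + 2 * μ / c * (K ^ 2 * ∫ ω, ‖X i ω‖ ^ 4 ∂P + μ ^ 2 * b ^ 2) := by
  have hcμ := h.mul_le_one
  have hcμ0 : 0 < c * μ := mul_pos hc hμ
  have iD : ∀ j, Integrable (fun ω => ‖X j ω - linearModel B C μ V j ω‖ ^ 2) P := fun j =>
    integrable_norm_sq ((h.memLp_error j).sub (h.memLp_linearModel j)).two_of_four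
  have iX := integrable_norm_pow_four (h.memLp_error i)
  have i1 : Integrable (fun ω => K ^ 2 * ‖X i ω‖ ^ 4 + μ ^ 2 * b ^ 2) P :=
    (iX.const_mul _).add (integrable_const _)
  calc _ ≤ ∫ ω, ((1 - c * μ) * ‖X i ω - linearModel B C μ V i ω‖ ^ 2
        + 2 * μ / c * (K ^ 2 * ‖X i ω‖ ^ 4 + μ ^ 2 * b ^ 2)) ∂P := by
        refine integral_mono (iD _) (((iD i).const_mul _).add (i1.const_mul _)) fun ω => ?_
        set x := X i ω
        set z := linearModel B C μ V i ω
        have e : X (i + 1) ω - linearModel B C μ V (i + 1) ω = (Φ x - B x) + B (x - z) := by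
          rw [h.step, map_sub]
          change Φ x - μ • C (V i ω) - (B z - μ • C (V i ω)) = _
          abel
        have h1 : ‖X (i + 1) ω - linearModel B C μ V (i + 1) ω‖
            ≤ (1 - c * μ) * ‖x - z‖ + c * μ * ((K * ‖x‖ ^ 2 + μ * b) / c) := by
          rw [e]
          refine (norm_add_le _ _).trans ?_
          have h2 := B.le_of_opNorm_le h.norm_linear (x - z)
          have h3 : c * μ * ((K * ‖x‖ ^ 2 + μ * b) / c) = μ * (K * ‖x‖ ^ 2) + μ ^ 2 * b := by
            field_simp
          linarith [h.linearize x]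
        refine (sq_le_of_le_convex (norm_nonneg _) hcμ0.le hcμ h1).trans ?_
        have h4 : c * μ * ((K * ‖x‖ ^ 2 + μ * b) / c) ^ 2
            = μ / c * (K * ‖x‖ ^ 2 + μ * b) ^ 2 := by field_simp
        have h5 : (K * ‖x‖ ^ 2 + μ * b) ^ 2 ≤ 2 * (K ^ 2 * ‖x‖ ^ 4 + μ ^ 2 * b ^ 2) := by
          nlinarith [sq_nonneg (K * ‖x‖ ^ 2 - μ * b)]
        have h6 := mul_le_mul_of_nonneg_left h5 (by positivity : 0 ≤ μ / c)
        rw [h4]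
        calc _ ≤ (1 - c * μ) * ‖x - z‖ ^ 2
            + μ / c * (2 * (K ^ 2 * ‖x‖ ^ 4 + μ ^ 2 * b ^ 2)) := by linarith
          _ = _ := by ring
    _ = _ := by
        rw [integral_add ((iD i).const_mul _) (i1.const_mul _), integral_const_mul,
          integral_const_mul, integral_add (iX.const_mul _) (integrable_const _),
          integral_const_mul]
        simp

/-- Up to order `μ ^ (3 / 2)` the mean-square error is that of the linear recursion. -/
theorem eventually_integral_sq_le {c b K : ℝ} [IsProbabilityMeasure P] (hc : 0 < c) (hK : 0 ≤ K) :
    ∃ K₂ > 0, ∃ μ₂ > 0, ∀ (μ : ℝ) (m : ℕ → MeasurableSpace Ω)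
      (X V : ℕ → Ω → EuclideanSpace ℝ ι) (Φ : EuclideanSpace ℝ ι → EuclideanSpace ℝ ι)
      (B C : EuclideanSpace ℝ ι →L[ℝ] EuclideanSpace ℝ ι), 0 < μ → μ < μ₂ →
      ErrorRecursion P m X V Φ B C μ c b K →
      ∀ᶠ i in atTop, ∫ ω, ‖X i ω‖ ^ 2 ∂P ≤ K₂ * μ ∧
        |∫ ω, ‖X i ω‖ ^ 2 ∂P - ∫ ω, ‖linearModel B C μ V i ω‖ ^ 2 ∂P| ≤ K₂ * (μ * √μ) := by
  obtain ⟨K₁, hK₁, μ₁, hμ₁, H⟩ := eventually_integral_pow_four_le (P := P) (ι := ι) (b := b) hc hK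
  set L := 2 / c * (K ^ 2 * K₁ + b ^ 2) + 1 with hL
  have hL0 : 0 < L := by positivity
  -- `1 + K₁` bounds the second moment, `4 L / c` comes from the distance to the linear recursion.
  refine ⟨(1 + K₁) + 4 * L / c, by positivity, min 1 μ₁, lt_min one_pos hμ₁, ?_⟩
  intro μ m X V Φ B C hμ hμ2 h
  have hμ1 : μ ≤ 1 := hμ2.le.trans (min_le_left _ _)
  have hcμ := h.mul_le_one
  have hcμ0 : 0 < c * μ := mul_pos hc hμ
  have hfour := H μ m X V Φ B C hμ (hμ2.trans_le (min_le_right _ _)) h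
  have hD := eventually_le_of_le_mul_add (q := 1 - c * μ)
    (u := fun i => ∫ ω, ‖X i ω - linearModel B C μ V i ω‖ ^ 2 ∂P) (b := L * μ ^ 3)
    (by linarith) (by linarith) (by positivity)
    (fun i => h.integral_sq_sub_linearModel_succ_le hμ hc i) (by
      filter_upwards [hfour] with i hi
      calc _ ≤ 2 * μ / c * (K ^ 2 * (K₁ * μ ^ 2) + μ ^ 2 * b ^ 2) := by gcongr
        _ = 2 / c * (K ^ 2 * K₁ + b ^ 2) * μ ^ 3 := by ring
        _ ≤ _ := by gcongr; rw [hL]; linarith)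
  have hs : 0 < √μ := Real.sqrt_pos.2 hμ
  have hss : √μ * √μ = μ := Real.mul_self_sqrt hμ.le
  have hs1 : √μ ≤ 1 := Real.sqrt_le_one.2 hμ1
  filter_upwards [hfour, hD] with i h4 hDi
  have h2 : ∫ ω, ‖X i ω‖ ^ 2 ∂P ≤ (1 + K₁) * μ := by
    refine (integral_norm_sq_le_of_pow_four (h.memLp_error i) hμ).trans ?_
    have : (∫ ω, ‖X i ω‖ ^ 4 ∂P) / μ ≤ K₁ * μ := by
      rw [div_le_iff₀ hμ]; linarith
    linarith
  have hDi' : ∫ ω, ‖X i ω - linearModel B C μ V i ω‖ ^ 2 ∂P ≤ 2 * L / c * μ ^ 2 := by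
    refine hDi.trans (le_of_eq ?_)
    field_simp
    ring
  have hpos : 0 ≤ 4 * L / c := by positivity
  refine ⟨h2.trans (by nlinarith), ?_⟩
  have iX := integrable_norm_sq (h.memLp_error i).two_of_four
  have iZ := integrable_norm_sq (h.memLp_linearModel i).two_of_four
  have iD := integrable_norm_sq ((h.memLp_error i).sub (h.memLp_linearModel i)).two_of_four
  rw [← integral_sub iX iZ]
  calc |∫ ω, (‖X i ω‖ ^ 2 - ‖linearModel B C μ V i ω‖ ^ 2) ∂P|
      ≤ ∫ ω, |‖X i ω‖ ^ 2 - ‖linearModel B C μ V i ω‖ ^ 2| ∂P := abs_integral_le_integral_abs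
    _ ≤ ∫ ω, (√μ * ‖X i ω‖ ^ 2
          + (1 / √μ + 1) * ‖X i ω - linearModel B C μ V i ω‖ ^ 2) ∂P :=
        integral_mono (iX.sub iZ).abs ((iX.const_mul _).add (iD.const_mul _)) fun ω =>
          abs_norm_sq_sub_norm_sq_le _ _ hs
    _ = √μ * ∫ ω, ‖X i ω‖ ^ 2 ∂P
          + (1 / √μ + 1) * ∫ ω, ‖X i ω - linearModel B C μ V i ω‖ ^ 2 ∂P := by
        rw [← integral_const_mul, ← integral_const_mul]
        exact integral_add (iX.const_mul _) (iD.const_mul _)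
    _ ≤ √μ * ((1 + K₁) * μ) + (1 / √μ + 1) * (2 * L / c * μ ^ 2) := by gcongr
    _ ≤ √μ * ((1 + K₁) * μ) + 2 / √μ * (2 * L / c * μ ^ 2) := by
        gcongr
        have : 1 ≤ 1 / √μ := by rwa [le_div_iff₀ hs, one_mul]
        calc _ ≤ 1 / √μ + 1 / √μ := by gcongr
          _ = _ := by ring
    _ = _ := by
        have : 2 / √μ * (2 * L / c * μ ^ 2) = 4 * L / c * (μ * √μ) := by
          rw [← hss]; simp only [Real.sqrt_mul_self hs.le]; field_simp; ring
        rw [this]; ring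

/-! ### Second moments of the linear recursion -/

/-- The mixed term vanishes since the noise is orthogonal to the past. The operator `A` in front makes
the identity fit for iteration. -/
theorem integral_sq_linearModel_succ [IsProbabilityMeasure P]
    (h : ErrorRecursion P m X V Φ B C μ c b K)
    (A : EuclideanSpace ℝ ι →L[ℝ] EuclideanSpace ℝ ι) (i : ℕ) :
    ∫ ω, ‖A (linearModel B C μ V (i + 1) ω)‖ ^ 2 ∂P
      = ∫ ω, ‖(A * B) (linearModel B C μ V i ω)‖ ^ 2 ∂P
        + μ ^ 2 * ∫ ω, ‖(A * C) (V i ω)‖ ^ 2 ∂P := by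
  have mZ : MemLp (fun ω => (A * B) (linearModel B C μ V i ω)) 2 P :=
    ((A * B).comp_memLp' (h.memLp_linearModel i)).two_of_four
  have mV : MemLp (fun ω => (A * C) (V i ω)) 2 P :=
    ((A * C).comp_memLp' (h.memLp_noise i)).two_of_four
  have iZ := integrable_norm_sq mZ
  have iV := integrable_norm_sq mV
  have iZV := integrable_inner_of_memLp_two mZ mV
  have h0 := h.integral_inner_noise i ((A * B).measurable.comp (h.measurable_linearModel i))
    (A * C) iZV
  have i1 : Integrable (fun ω => ‖(A * B) (linearModel B C μ V i ω)‖ ^ 2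
      - 2 * μ * inner ℝ ((A * B) (linearModel B C μ V i ω)) ((A * C) (V i ω))) P :=
    iZ.sub (iZV.const_mul _)
  calc _ = ∫ ω, (‖(A * B) (linearModel B C μ V i ω)‖ ^ 2
        - 2 * μ * inner ℝ ((A * B) (linearModel B C μ V i ω)) ((A * C) (V i ω))
        + μ ^ 2 * ‖(A * C) (V i ω)‖ ^ 2) ∂P := by
        refine integral_congr_ae (ae_of_all _ fun ω => ?_)
        have e : A (linearModel B C μ V (i + 1) ω)
            = (A * B) (linearModel B C μ V i ω) - μ • (A * C) (V i ω) := by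
          change A (B (linearModel B C μ V i ω) - μ • C (V i ω)) = _
          rw [map_sub, map_smul]; rfl
        dsimp only
        rw [e, norm_sub_sq_real, real_inner_smul_right, norm_smul, mul_pow, Real.norm_eq_abs,
          sq_abs]
        ring
    _ = _ := by
        rw [integral_add i1 (iV.const_mul _), integral_sub iZ (iZV.const_mul _),
          integral_const_mul, integral_const_mul]
        simp only [Function.comp_def] at h0
        rw [h0]
        ring

theorem integral_sq_linearModel [IsProbabilityMeasure P]
    (h : ErrorRecursion P m X V Φ B C μ c b K) (i : ℕ)
    (A : EuclideanSpace ℝ ι →L[ℝ] EuclideanSpace ℝ ι) :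
    ∫ ω, ‖A (linearModel B C μ V i ω)‖ ^ 2 ∂P
      = ∑ j ∈ Finset.range i, μ ^ 2 * ∫ ω, ‖(A * B ^ (i - 1 - j) * C) (V j ω)‖ ^ 2 ∂P := by
  induction i generalizing A with
  | zero => simp [linearModel]
  | succ i ih =>
    rw [h.integral_sq_linearModel_succ, ih, Finset.sum_range_succ]
    congr 1
    · refine Finset.sum_congr rfl fun j hj => ?_
      have hj' : i + 1 - 1 - j = (i - 1 - j) + 1 := by have := Finset.mem_range.1 hj; omega
      rw [hj', pow_succ' B, ← mul_assoc A B]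
    · simp

/-- The sum `μ² ∑ R x y ⟪Bⁿ C e_x, Bⁿ C e_y⟫`, that is, the trace of `μ² Bⁿ C R (Bⁿ C)ᵀ`. -/
def powerForm [DecidableEq ι] (B C : EuclideanSpace ℝ ι →L[ℝ] EuclideanSpace ℝ ι)
    (R : Matrix ι ι ℝ) (μ : ℝ) (n : ℕ) : ℝ :=
  μ ^ 2 * ∑ x, ∑ y, R x y * inner ℝ ((B ^ n * C) (EuclideanSpace.single x 1))
    ((B ^ n * C) (EuclideanSpace.single y 1))

theorem norm_map_sq_eq_sum [DecidableEq ι] (A : EuclideanSpace ℝ ι →L[ℝ] EuclideanSpace ℝ ι)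
    (v : EuclideanSpace ℝ ι) :
    ‖A v‖ ^ 2 = ∑ x, ∑ y, v x * v y * inner ℝ (A (EuclideanSpace.single x 1))
      (A (EuclideanSpace.single y 1)) := by
  have hv : A v = ∑ x, v x • A (EuclideanSpace.single x 1) := by
    conv_lhs => rw [← (EuclideanSpace.basisFun ι ℝ).sum_repr v]
    simp
  rw [← real_inner_self_eq_norm_sq, hv, sum_inner]
  refine Finset.sum_congr rfl fun x _ => ?_
  rw [inner_sum]
  refine Finset.sum_congr rfl fun y _ => ?_
  rw [real_inner_smul_left, real_inner_smul_right]; ring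

theorem integrable_coord_mul (h : ErrorRecursion P m X V Φ B C μ c b K) [IsProbabilityMeasure P]
    (i : ℕ) (x y : ι) : Integrable (fun ω => V i ω x * V i ω y) P := by
  have hV : ∀ z, MemLp (fun ω => V i ω z) 2 P := fun z =>
    ((EuclideanSpace.proj (𝕜 := ℝ) z).comp_memLp' (h.memLp_noise i)).two_of_four
  exact (hV x).integrable_mul (hV y)

theorem norm_pow_le (h : ErrorRecursion P m X V Φ B C μ c b K) (n : ℕ) :
    ‖B ^ n‖ ≤ (1 - c * μ) ^ n := by
  induction n with
  | zero => rw [pow_zero, pow_zero]; exact ContinuousLinearMap.norm_id_le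
  | succ n ih =>
    rw [pow_succ, pow_succ]
    exact (norm_mul_le _ _).trans (mul_le_mul ih h.norm_linear (norm_nonneg _)
      (pow_nonneg ((norm_nonneg _).trans h.norm_linear) n))

theorem abs_inner_le_pow [DecidableEq ι] (h : ErrorRecursion P m X V Φ B C μ c b K) (hμ : 0 < μ)
    (hc : 0 < c) (n : ℕ) (x y : ι) :
    |inner ℝ ((B ^ n * C) (EuclideanSpace.single x 1)) ((B ^ n * C) (EuclideanSpace.single y 1))|
      ≤ (1 - c * μ) ^ n := by
  have hq : 0 ≤ 1 - c * μ := (norm_nonneg _).trans h.norm_linear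
  have h1 : ‖B ^ n * C‖ ≤ (1 - c * μ) ^ n := by
    refine (norm_mul_le _ _).trans ?_
    calc _ ≤ (1 - c * μ) ^ n * 1 :=
          mul_le_mul (h.norm_pow_le n) h.norm_comb (norm_nonneg _) (pow_nonneg hq n)
      _ = _ := mul_one _
  have h2 : ∀ z : ι, ‖(B ^ n * C) (EuclideanSpace.single z 1)‖ ≤ (1 - c * μ) ^ n := fun z => by
    simpa using (B ^ n * C).le_of_opNorm_le h1 (EuclideanSpace.single z (1 : ℝ))
  have h3 : (1 - c * μ) ^ n ≤ 1 := pow_le_one₀ hq (by nlinarith)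
  refine (abs_real_inner_le_norm _ _).trans ?_
  -- One of the two factors is enough for a geometric series of ratio `1 - c μ`.
  calc _ ≤ (1 - c * μ) ^ n * (1 - c * μ) ^ n :=
        mul_le_mul (h2 x) (h2 y) (norm_nonneg _) (pow_nonneg hq n)
    _ ≤ (1 - c * μ) ^ n * 1 := by gcongr
    _ = _ := mul_one _

theorem summable_powerForm [DecidableEq ι] (h : ErrorRecursion P m X V Φ B C μ c b K)
    (hμ : 0 < μ) (hc : 0 < c) (R : Matrix ι ι ℝ) : Summable (powerForm B C R μ) := by
  have hq : 0 ≤ 1 - c * μ := (norm_nonneg _).trans h.norm_linear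
  refine Summable.of_norm_bounded (g := fun n => (1 - c * μ) ^ n * (μ ^ 2 * ∑ x, ∑ y, |R x y|))
    ((summable_geometric_of_lt_one hq (by nlinarith)).mul_right _) fun n => ?_
  rw [powerForm, Real.norm_eq_abs, abs_mul, abs_of_nonneg (sq_nonneg μ), mul_left_comm]
  refine mul_le_mul_of_nonneg_left ?_ (sq_nonneg μ)
  rw [Finset.mul_sum]
  refine (Finset.abs_sum_le_sum_abs _ _).trans (Finset.sum_le_sum fun x _ => ?_)
  rw [Finset.mul_sum]
  refine (Finset.abs_sum_le_sum_abs _ _).trans (Finset.sum_le_sum fun y _ => ?_)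
  rw [abs_mul, mul_comm]
  exact mul_le_mul_of_nonneg_right (h.abs_inner_le_pow hμ hc n x y) (abs_nonneg _)

/-- If the second moments of the noise are eventually within `δ` of the matrix `R`, those of the
linear recursion are eventually within a multiple of `μ δ` of the partial sums of the series built
from `R`. -/
theorem eventually_integral_sq_linearModel [DecidableEq ι] [IsProbabilityMeasure P]
    (h : ErrorRecursion P m X V Φ B C μ c b K) (hμ : 0 < μ) (hc : 0 < c) (R : Matrix ι ι ℝ)
    {δ : ℝ} (hδ : 0 < δ)
    (hR : ∀ᶠ i in atTop, ∑ x, ∑ y, |∫ ω, V i ω x * V i ω y ∂P - R x y| ≤ δ) :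
    ∀ᶠ i in atTop, |∫ ω, ‖linearModel B C μ V i ω‖ ^ 2 ∂P
      - ∑ n ∈ Finset.range i, powerForm B C R μ n| ≤ 2 * (μ * δ / c) := by
  have hq : 0 ≤ 1 - c * μ := (norm_nonneg _).trans h.norm_linear
  have hcμ0 : 0 < c * μ := mul_pos hc hμ
  set d : ℕ → ℝ := fun i => ∑ x, ∑ y, |∫ ω, V i ω x * V i ω y ∂P - R x y| with hd
  set u : ℕ → ℝ := fun i => ∑ j ∈ Finset.range i, (1 - c * μ) ^ (i - 1 - j) * (μ ^ 2 * d j) with hu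
  have hrec : ∀ i, u (i + 1) ≤ (1 - c * μ) * u i + μ ^ 2 * d i := by
    intro i
    refine le_of_eq ?_
    simp only [hu]
    rw [Finset.sum_range_succ, Finset.mul_sum (Finset.range i)]
    refine congrArg₂ (· + ·) (Finset.sum_congr rfl fun j hj => ?_) (by simp)
    have hj' : i + 1 - 1 - j = (i - 1 - j) + 1 := by have := Finset.mem_range.1 hj; omega
    rw [hj', pow_succ']; ring
  have hev := eventually_le_of_le_mul_add hq (by linarith) (b := μ ^ 2 * δ) (by positivity) hrec
    (by filter_upwards [hR] with i hi; exact mul_le_mul_of_nonneg_left hi (sq_nonneg μ))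
  filter_upwards [hev] with i hi
  have e1 : 2 * (μ ^ 2 * δ / (1 - (1 - c * μ))) = 2 * (μ * δ / c) := by field_simp; ring
  rw [e1] at hi
  refine le_trans ?_ hi
  have e2 := h.integral_sq_linearModel i 1
  simp only [one_mul, one_apply_eq_self] at e2
  rw [e2, ← Finset.sum_range_reflect (powerForm B C R μ), ← Finset.sum_sub_distrib]
  refine (Finset.abs_sum_le_sum_abs _ _).trans (Finset.sum_le_sum fun j _ => ?_)
  set A := B ^ (i - 1 - j) * C with hA
  have e3 : ∫ ω, ‖A (V j ω)‖ ^ 2 ∂P = ∑ x, ∑ y, (∫ ω, V j ω x * V j ω y ∂P)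
      * inner ℝ (A (EuclideanSpace.single x 1)) (A (EuclideanSpace.single y 1)) := by
    simp_rw [norm_map_sq_eq_sum A]
    rw [integral_finsetSum _ fun x _ => integrable_finsetSum _ fun y _ =>
      (h.integrable_coord_mul j x y).mul_const _]
    refine Finset.sum_congr rfl fun x _ => ?_
    rw [integral_finsetSum _ fun y _ => (h.integrable_coord_mul j x y).mul_const _]
    exact Finset.sum_congr rfl fun y _ => integral_mul_const _ _
  rw [e3, powerForm, ← hA, ← mul_sub, abs_mul, abs_of_nonneg (sq_nonneg μ), mul_left_comm]
  refine mul_le_mul_of_nonneg_left ?_ (sq_nonneg μ)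
  rw [← Finset.sum_sub_distrib, hd, Finset.mul_sum]
  refine (Finset.abs_sum_le_sum_abs _ _).trans (Finset.sum_le_sum fun x _ => ?_)
  rw [← Finset.sum_sub_distrib, Finset.mul_sum]
  refine (Finset.abs_sum_le_sum_abs _ _).trans (Finset.sum_le_sum fun y _ => ?_)
  rw [← sub_mul, abs_mul, mul_comm]
  exact mul_le_mul_of_nonneg_right (h.abs_inner_le_pow hμ hc _ x y) (abs_nonneg _)

end ErrorRecursion
end Recursion

/-! ### Gradient steps for strongly convex costs -/

namespace StronglyConvexCost

variable {M : ℕ} {f : Param M → ℝ} {lmin lmax : ℝ}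

theorem hasFDerivAt_gradient (h : StronglyConvexCost f lmin lmax) (w : Param M) :
    HasFDerivAt (gradient f) (hessian f w) w :=
  (h.differentiable_gradient w).hasFDerivAt

/-- The Hessian is symmetric, as the second derivative of `f`. -/
theorem inner_hessian_comm (h : StronglyConvexCost f lmin lmax) (w u v : Param M) :
    inner ℝ (hessian f w u) v = inner ℝ (hessian f w v) u := by
  have h1 : ∀ y, HasFDerivAt f (innerSL ℝ (gradient f y)) y := fun y =>
    (h.differentiable y).hasGradientAt.hasFDerivAt
  have h2 : HasFDerivAt (fun y => innerSL ℝ (gradient f y))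
      ((innerSL ℝ (E := Param M)).comp (hessian f w)) w :=
    (innerSL ℝ (E := Param M)).hasFDerivAt.comp w (h.hasFDerivAt_gradient w)
  exact second_derivative_symmetric h1 h2 u v

/-- A symmetric operator with `0 ≤ ⟪v, H v⟫ ≤ Λ ‖v‖ ^ 2` has norm at most `Λ`. The bound `lmax` itself
may be negative when the parameter space is trivial. -/
theorem norm_hessian_le (h : StronglyConvexCost f lmin lmax) {Λ : ℝ} (hΛ : lmax ≤ Λ) (hΛ0 : 0 ≤ Λ)
    (w : Param M) : ‖hessian f w‖ ≤ Λ := by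
  refine ContinuousLinearMap.opNorm_le_bound _ hΛ0 fun v => ?_
  set H := hessian f w
  have hup : ∀ u, inner ℝ u (H u) ≤ Λ * ‖u‖ ^ 2 := fun u =>
    (h.upper w u).trans (mul_le_mul_of_nonneg_right hΛ (sq_nonneg _))
  have hlo : ∀ u, 0 ≤ inner ℝ u (H u) := fun u =>
    (mul_nonneg h.pos.le (sq_nonneg _)).trans (h.lower w u)
  have hsymm : inner ℝ v (H (H v)) = ‖H v‖ ^ 2 := by
    rw [real_inner_comm, h.inner_hessian_comm, real_inner_self_eq_norm_sq]
  rcases eq_or_lt_of_le hΛ0 with h0 | h0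
  · have h1 : inner ℝ v (H v) = 0 := le_antisymm (by simpa [← h0] using hup v) (hlo v)
    -- The form vanishes at `v + H v` as well, and hence `‖H v‖ ^ 2 = 0`.
    have h2 := hup (v + H v)
    have h3 := hlo (H v)
    rw [← h0] at h2 ⊢
    simp only [map_add, inner_add_left, inner_add_right, h1, hsymm,
      real_inner_self_eq_norm_sq] at h2
    have : ‖H v‖ ^ 2 ≤ 0 := by linarith
    have := pow_eq_zero_iff (n := 2) (by norm_num) |>.1 (le_antisymm this (sq_nonneg ‖H v‖))
    rw [this, zero_mul]
  · -- Nonnegativity of the form at `H v - Λ v`, combined with the upper bound at `H v`.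
    have h1 := hlo (H v - Λ • v)
    have h2 := hup (H v)
    have h3 := hup v
    simp only [map_sub, map_smul, inner_sub_left, inner_sub_right, real_inner_smul_left,
      real_inner_smul_right, hsymm, real_inner_self_eq_norm_sq] at h1
    have h4 : Λ * ‖H v‖ ^ 2 ≤ Λ * (Λ * ‖v‖) ^ 2 := by
      nlinarith [mul_le_mul_of_nonneg_left h3 (sq_nonneg Λ)]
    exact le_of_sq_le_sq (le_of_mul_le_mul_left h4 h0) (by positivity)

theorem norm_gradient_sub_le (h : StronglyConvexCost f lmin lmax) {Λ : ℝ} (hΛ : lmax ≤ Λ)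
    (hΛ0 : 0 ≤ Λ) (w w' : Param M) : ‖gradient f w - gradient f w'‖ ≤ Λ * ‖w - w'‖ :=
  convex_univ.norm_image_sub_le_of_norm_hasFDerivWithin_le
    (fun x _ => (h.hasFDerivAt_gradient x).hasFDerivWithinAt)
    (fun x _ => h.norm_hessian_le hΛ hΛ0 x) (Set.mem_univ _) (Set.mem_univ _)

theorem norm_sub_smul_hessian_le (h : StronglyConvexCost f lmin lmax) {Λ c μ : ℝ} (hΛ : lmax ≤ Λ)
    (hΛ0 : 0 ≤ Λ) (hc : 2 * c ≤ lmin) (hμ : 0 ≤ μ) (hμΛ : μ * Λ ^ 2 ≤ lmin) (hcμ : c * μ ≤ 1)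
    (w v : Param M) : ‖v - μ • hessian f w v‖ ≤ (1 - c * μ) * ‖v‖ := by
  have h1 := (hessian f w).le_of_opNorm_le (h.norm_hessian_le hΛ hΛ0 w) v
  have h2 : ‖hessian f w v‖ ^ 2 ≤ (Λ * ‖v‖) ^ 2 := pow_le_pow_left₀ (norm_nonneg _) h1 2
  have h3 := h.lower w v
  refine le_of_sq_le_sq ?_ (mul_nonneg (by linarith) (norm_nonneg _))
  rw [norm_sub_sq_real, real_inner_smul_right, norm_smul, mul_pow, Real.norm_eq_abs, sq_abs]
  have h4 : μ ^ 2 * ‖hessian f w v‖ ^ 2 ≤ μ * lmin * ‖v‖ ^ 2 := by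
    calc μ ^ 2 * ‖hessian f w v‖ ^ 2 ≤ μ ^ 2 * (Λ * ‖v‖) ^ 2 := by gcongr
      _ = μ * (μ * Λ ^ 2) * ‖v‖ ^ 2 := by ring
      _ ≤ _ := by gcongr
  have h5 := mul_le_mul_of_nonneg_left h3 hμ
  have h6 : 2 * c * (μ * ‖v‖ ^ 2) ≤ lmin * (μ * ‖v‖ ^ 2) :=
    mul_le_mul_of_nonneg_right hc (by positivity)
  nlinarith [sq_nonneg (c * μ * ‖v‖)]

theorem norm_gradient_step_sub_le (h : StronglyConvexCost f lmin lmax) {Λ c μ : ℝ}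
    (hΛ : lmax ≤ Λ) (hΛ0 : 0 ≤ Λ) (hc : 2 * c ≤ lmin) (hμ : 0 ≤ μ) (hμΛ : μ * Λ ^ 2 ≤ lmin)
    (hcμ : c * μ ≤ 1) (w w' : Param M) :
    ‖(w - μ • gradient f w) - (w' - μ • gradient f w')‖ ≤ (1 - c * μ) * ‖w - w'‖ := by
  refine convex_univ.norm_image_sub_le_of_norm_hasFDerivWithin_le
    (f := fun w => w - μ • gradient f w)
    (f' := fun x => ContinuousLinearMap.id ℝ (Param M) - μ • hessian f x)
    (fun x _ => ((hasFDerivAt_id x).sub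
      ((h.hasFDerivAt_gradient x).const_smul μ)).hasFDerivWithinAt)
    (fun x _ => ContinuousLinearMap.opNorm_le_bound _ (by linarith) fun v => ?_)
    (Set.mem_univ _) (Set.mem_univ _)
  exact h.norm_sub_smul_hessian_le hΛ hΛ0 hc hμ hμΛ hcμ x v

/-- The linearization error of the gradient is quadratic on the whole space: near `w` because the
Hessian is Lipschitz there, and away from `w` because it is bounded. -/
theorem norm_gradient_linearization_le (h : StronglyConvexCost f lmin lmax) {Λ κ ε : ℝ}
    (hΛ : lmax ≤ Λ) (hΛ0 : 0 ≤ Λ) (hκ : 0 ≤ κ) (hε : 0 < ε) {w : Param M}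
    (hH : HessianLipschitzNear f w κ ε) (x : Param M) :
    ‖gradient f w - gradient f (w - x) - hessian f w x‖ ≤ (κ + 2 * Λ / ε) * ‖x‖ ^ 2 := by
  have hpos : 0 ≤ 2 * Λ / ε := by positivity
  rcases le_or_gt ‖x‖ ε with hx | hx
  · have hd : ∀ y, HasFDerivAt (fun y => gradient f (w - y) + hessian f w y)
        (hessian f w - hessian f (w - y)) y := by
      intro y
      have h1 : HasFDerivAt (fun y : Param M => w - y) (-ContinuousLinearMap.id ℝ (Param M)) y := by
        simpa using (hasFDerivAt_id y).const_sub w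
      have h2 := ((h.hasFDerivAt_gradient (w - y)).comp y h1).add (hessian f w).hasFDerivAt
      refine h2.congr_fderiv ?_
      ext1 v
      simp [sub_eq_add_neg, add_comm]
    have hb : ∀ y ∈ Metric.closedBall (0 : Param M) ‖x‖,
        ‖hessian f w - hessian f (w - y)‖ ≤ κ * ‖x‖ := by
      intro y hy
      rw [mem_closedBall_zero_iff] at hy
      have := hH (-y) (by rw [norm_neg]; exact hy.trans hx)
      rw [norm_neg, ← sub_eq_add_neg] at this
      rw [norm_sub_rev]
      exact this.trans (mul_le_mul_of_nonneg_left hy hκ)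
    have := (convex_closedBall (0 : Param M) ‖x‖).norm_image_sub_le_of_norm_hasFDerivWithin_le
      (fun y _ => (hd y).hasFDerivWithinAt) hb (x := x) (y := 0) (by simp) (by simp)
    simp only [sub_zero, map_zero, add_zero, zero_sub, norm_neg] at this
    rw [← sub_add_eq_sub_sub]
    refine this.trans ?_
    nlinarith [mul_nonneg hpos (sq_nonneg ‖x‖)]
  · have h1 := h.norm_gradient_sub_le hΛ hΛ0 w (w - x)
    rw [sub_sub_cancel] at h1
    have h2 := (hessian f w).le_of_opNorm_le (h.norm_hessian_le hΛ hΛ0 w) x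
    have h3 : 2 * Λ * ‖x‖ ≤ 2 * Λ / ε * ‖x‖ ^ 2 := by
      have : 2 * Λ / ε * ‖x‖ ^ 2 = 2 * Λ * ‖x‖ * (‖x‖ / ε) := by field_simp
      rw [this]
      exact le_mul_of_one_le_right (by positivity) ((one_le_div hε).2 hx.le)
    refine (norm_sub_le _ _).trans ?_
    nlinarith [mul_nonneg hκ (sq_nonneg ‖x‖)]

end StronglyConvexCost

/-! ### Network vectors and the combination matrix -/

section Network
variable {N M : ℕ}

/-- The Euclidean space of network vectors. -/
abbrev NetSpace (N M : ℕ) : Type := EuclideanSpace ℝ (NetIdx N M)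

/-- Stacking `N` parameter vectors, `col {w_1, …, w_N}`, as a map onto the Euclidean space of network
vectors. -/
def stack : (Fin N → Param M) ≃L[ℝ] NetSpace N M :=
  LinearEquiv.toContinuousLinearEquiv
    { toFun := fun W => WithLp.toLp 2 (col W)
      invFun := fun x k => WithLp.toLp 2 fun a => x (k, a)
      map_add' := fun _ _ => rfl
      map_smul' := fun _ _ => rfl
      left_inv := fun _ => rfl
      right_inv := fun _ => rfl }

@[simp] theorem stack_apply (W : Fin N → Param M) (k : Fin N) (a : Fin M) :
    stack W (k, a) = W k a := rfl

theorem norm_stack_sq (W : Fin N → Param M) : ‖stack W‖ ^ 2 = ∑ k, ‖W k‖ ^ 2 := by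
  simp only [EuclideanSpace.real_norm_sq_eq, Fintype.sum_prod_type, stack_apply]

theorem norm_le_norm_stack (W : Fin N → Param M) (k : Fin N) : ‖W k‖ ≤ ‖stack W‖ := by
  refine le_of_sq_le_sq ?_ (norm_nonneg _)
  rw [norm_stack_sq]
  exact Finset.single_le_sum (f := fun k => ‖W k‖ ^ 2) (fun _ _ => sq_nonneg _)
    (Finset.mem_univ k)

theorem norm_stack_le_mul {U W : Fin N → Param M} {a : ℝ} (ha : 0 ≤ a)
    (h : ∀ k, ‖U k‖ ≤ a * ‖W k‖) : ‖stack U‖ ≤ a * ‖stack W‖ := by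
  refine le_of_sq_le_sq ?_ (mul_nonneg ha (norm_nonneg _))
  rw [mul_pow, norm_stack_sq, norm_stack_sq, Finset.mul_sum]
  refine Finset.sum_le_sum fun k _ => ?_
  rw [← mul_pow]
  exact pow_le_pow_left₀ (norm_nonneg _) (h k) 2

theorem norm_stack_le_mul_sq {U W : Fin N → Param M} {a : ℝ} (ha : 0 ≤ a)
    (h : ∀ k, ‖U k‖ ≤ a * ‖W k‖ ^ 2) : ‖stack U‖ ≤ a * ‖stack W‖ ^ 2 := by
  refine le_of_sq_le_sq ?_ (mul_nonneg ha (sq_nonneg _))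
  rw [mul_pow, norm_stack_sq, norm_stack_sq]
  calc ∑ k, ‖U k‖ ^ 2 ≤ ∑ k, a ^ 2 * (‖W k‖ ^ 2) ^ 2 := by
        refine Finset.sum_le_sum fun k _ => ?_
        rw [← mul_pow]
        exact pow_le_pow_left₀ (norm_nonneg _) (h k) 2
    _ = a ^ 2 * ∑ k, (‖W k‖ ^ 2) ^ 2 := by rw [Finset.mul_sum]
    _ ≤ a ^ 2 * (∑ k, ‖W k‖ ^ 2) ^ 2 := by
        gcongr
        exact Finset.sum_sq_le_sq_sum_of_nonneg fun k _ => sq_nonneg _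

theorem netLaplacian_apply (A : Matrix (Fin N) (Fin N) ℝ) (x y : NetIdx N M) :
    netLaplacian M A x y = laplacian A x.1 y.1 * (1 : Matrix (Fin M) (Fin M) ℝ) x.2 y.2 := rfl

theorem netLaplacian_mulVec (A : Matrix (Fin N) (Fin N) ℝ) (v : NetIdx N M → ℝ) (k : Fin N)
    (a : Fin M) : (netLaplacian M A).mulVec v (k, a) = ∑ l, A k l * (v (k, a) - v (l, a)) := by
  have h1 : (netLaplacian M A).mulVec v (k, a) = ∑ l, laplacian A k l * v (l, a) := by
    simp [Matrix.mulVec, dotProduct, Fintype.sum_prod_type, netLaplacian_apply, Matrix.one_apply]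
  rw [h1]
  simp only [laplacian, Matrix.sub_apply, sub_mul, Finset.sum_sub_distrib, Matrix.diagonal_apply,
    mul_sub, ite_mul, zero_mul, Finset.sum_ite_eq, Finset.mem_univ, if_true, Finset.sum_mul]

theorem netLaplacian_transpose {A : Matrix (Fin N) (Fin N) ℝ} (hA : A.IsSymm) :
    (netLaplacian M A).transpose = netLaplacian M A := by
  have hL : (laplacian A).transpose = laplacian A := by
    rw [laplacian, Matrix.transpose_sub, Matrix.diagonal_transpose, hA.eq]
  rw [netLaplacian, ← Matrix.kroneckerMap_transpose, hL, Matrix.transpose_one]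

theorem combination_transpose {A : Matrix (Fin N) (Fin N) ℝ} (hA : A.IsSymm) (η μ : ℝ) :
    (combination M A η μ).transpose = combination M A η μ := by
  rw [combination, Matrix.transpose_sub, Matrix.transpose_smul, netLaplacian_transpose hA,
    Matrix.transpose_one]

/-- The matrix `L ⊗ I_M` as an operator. -/
def lapOp (M : ℕ) (A : Matrix (Fin N) (Fin N) ℝ) : NetSpace N M →L[ℝ] NetSpace N M :=
  Matrix.toEuclideanCLM (𝕜 := ℝ) (netLaplacian M A)

/-- The combination matrix as an operator. -/
def combOp (M : ℕ) (A : Matrix (Fin N) (Fin N) ℝ) (η μ : ℝ) : NetSpace N M →L[ℝ] NetSpace N M :=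
  Matrix.toEuclideanCLM (𝕜 := ℝ) (combination M A η μ)

theorem lapOp_stack (A : Matrix (Fin N) (Fin N) ℝ) (W : Fin N → Param M) :
    lapOp M A (stack W) = stack fun k => ∑ l, A k l • (W k - W l) := by
  ext ⟨k, a⟩
  have h := netLaplacian_mulVec A (col W) k a
  rw [stack_apply]
  change (netLaplacian M A).mulVec (col W) (k, a) = _
  rw [h]
  simp [col]

theorem combOp_eq (A : Matrix (Fin N) (Fin N) ℝ) (η μ : ℝ) :
    combOp M A η μ = 1 - (μ * η) • lapOp M A := by
  rw [combOp, lapOp, combination, map_sub, map_one, map_smul]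

theorem combOp_apply (A : Matrix (Fin N) (Fin N) ℝ) (η μ : ℝ) (x : NetSpace N M) :
    combOp M A η μ x = x - (μ * η) • lapOp M A x := by
  rw [combOp_eq]; rfl

theorem combOp_stack (A : Matrix (Fin N) (Fin N) ℝ) (η μ : ℝ) (W : Fin N → Param M) :
    combOp M A η μ (stack W) = stack (combineStep A η μ W) := by
  rw [combOp_apply, lapOp_stack, ← map_smul, ← map_sub]
  rfl

/-- A doubly stochastic matrix does not increase the Euclidean norm. -/
theorem norm_toEuclideanCLM_le_one {ι : Type*} [Fintype ι] [DecidableEq ι] {S : Matrix ι ι ℝ}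
    (h0 : ∀ x y, 0 ≤ S x y) (hrow : ∀ x, ∑ y, S x y = 1) (hcol : ∀ y, ∑ x, S x y = 1) :
    ‖Matrix.toEuclideanCLM (𝕜 := ℝ) S‖ ≤ 1 := by
  refine ContinuousLinearMap.opNorm_le_bound _ zero_le_one fun v => ?_
  rw [one_mul]
  refine le_of_sq_le_sq ?_ (norm_nonneg _)
  rw [EuclideanSpace.real_norm_sq_eq, EuclideanSpace.real_norm_sq_eq]
  calc ∑ x, (Matrix.toEuclideanCLM (𝕜 := ℝ) S v) x ^ 2
      ≤ ∑ x, ∑ y, S x y * v y ^ 2 := by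
        refine Finset.sum_le_sum fun x _ => ?_
        have := Real.pow_arith_mean_le_arith_mean_pow_of_even Finset.univ (S x) v
          (fun y _ => h0 x y) (hrow x) (n := 2) even_two
        exact this
    _ = ∑ y, v y ^ 2 := by
        rw [Finset.sum_comm]
        refine Finset.sum_congr rfl fun y _ => ?_
        rw [← Finset.sum_mul, hcol, one_mul]

theorem norm_combOp_le {A : Matrix (Fin N) (Fin N) ℝ} (hA : A.IsSymm) {η μ : ℝ}
    (h : CombinationCondition M A η μ) : ‖combOp M A η μ‖ ≤ 1 := by
  have hrow : ∀ x, ∑ y, combination M A η μ x y = 1 := by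
    rintro ⟨k, a⟩
    have h1 : (netLaplacian M A).mulVec (fun _ => 1) (k, a) = 0 := by
      rw [netLaplacian_mulVec]; simp
    have h2 : ∑ y, netLaplacian M A (k, a) y = 0 := by
      simpa [Matrix.mulVec, dotProduct] using h1
    simp only [combination, Matrix.sub_apply, Matrix.smul_apply, Finset.sum_sub_distrib,
      ← Finset.smul_sum, h2, smul_zero, sub_zero, Matrix.one_apply, Finset.sum_ite_eq,
      Finset.mem_univ, if_true]
  refine norm_toEuclideanCLM_le_one h.nonneg hrow fun y => ?_
  rw [← hrow y]
  refine Finset.sum_congr rfl fun x _ => ?_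
  conv_rhs => rw [← combination_transpose hA]
  rfl

end Network

/-! ### The drift of the error recursion -/

section Drift
variable {N M : ℕ} {A : Matrix (Fin N) (Fin N) ℝ} {η : ℝ} {J : Fin N → Param M → ℝ}
  {lmin lmax : Fin N → ℝ} {wo : Fin N → Param M}

/-- The gradients of all agents, stacked. -/
def gradStack (J : Fin N → Param M → ℝ) (W : Fin N → Param M) : NetSpace N M :=
  stack fun k => gradient (J k) (W k)

/-- The diagonal block matrix of the Hessians as an operator. -/
def hessOp (J : Fin N → Param M → ℝ) (wo : Fin N → Param M) : NetSpace N M →L[ℝ] NetSpace N M :=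
  Matrix.toEuclideanCLM (𝕜 := ℝ) (blockDiag fun k => hessianMatrix (J k) (wo k))

theorem hessOp_stack (J : Fin N → Param M → ℝ) (wo W : Fin N → Param M) :
    hessOp J wo (stack W) = stack fun k => hessian (J k) (wo k) (W k) := by
  ext ⟨k, a⟩
  rw [stack_apply]
  have h1 : hessOp J wo (stack W) (k, a)
      = ∑ b, W k b * hessian (J k) (wo k) (EuclideanSpace.single b 1) a := by
    change (blockDiag fun k => hessianMatrix (J k) (wo k)).mulVec (col W) (k, a) = _
    simp [Matrix.mulVec, dotProduct, Fintype.sum_prod_type, blockDiag, hessianMatrix, col,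
      Finset.sum_ite_irrel, mul_comm]
  rw [h1]
  conv_rhs => rw [← (EuclideanSpace.basisFun (Fin M) ℝ).sum_repr (W k)]
  simp

/-- The minimizer of the regularized cost is a stationary point. -/
theorem gradStack_add_lapOp_eq_zero (hA : A.IsSymm)
    (hJ : ∀ k, StronglyConvexCost (J k) (lmin k) (lmax k))
    (hwo : IsMinOn (globalCost A J η) Set.univ wo) :
    gradStack J wo + η • lapOp M A (stack wo) = 0 := by
  set r : Fin N → Param M := stack.symm (gradStack J wo + η • lapOp M A (stack wo)) with hr
  have hr' : stack r = gradStack J wo + η • lapOp M A (stack wo) := by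
    rw [hr, ContinuousLinearEquiv.apply_symm_apply]
  -- The derivative of the cost at `wo` in the direction `r` is `‖r‖ ^ 2`.
  have hquad : ∀ t : ℝ, col (wo + t • r) ⬝ᵥ (netLaplacian M A).mulVec (col (wo + t • r))
      = col wo ⬝ᵥ (netLaplacian M A).mulVec (col wo)
        + t * (2 * inner ℝ (stack r) (lapOp M A (stack wo)))
        + t ^ 2 * (col r ⬝ᵥ (netLaplacian M A).mulVec (col r)) := by
    intro t
    have e : col (wo + t • r) = col wo + t • col r := rfl
    have e2 : inner ℝ (stack r) (lapOp M A (stack wo))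
        = col r ⬝ᵥ (netLaplacian M A).mulVec (col wo) := Matrix.inner_toEuclideanCLM _ _ _
    have e3 : col wo ⬝ᵥ (netLaplacian M A).mulVec (col r)
        = col r ⬝ᵥ (netLaplacian M A).mulVec (col wo) := by
      rw [Matrix.dotProduct_mulVec, ← Matrix.mulVec_transpose, netLaplacian_transpose hA,
        dotProduct_comm]
    rw [e, e2, Matrix.mulVec_add, Matrix.mulVec_smul]
    simp only [add_dotProduct, dotProduct_add, smul_dotProduct, dotProduct_smul, smul_eq_mul, e3]
    ring
  have hder : HasDerivAt (fun t : ℝ => globalCost A J η (wo + t • r))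
      (∑ k, inner ℝ (gradient (J k) (wo k)) (r k)
        + η / 2 * (2 * inner ℝ (stack r) (lapOp M A (stack wo)))) 0 := by
    unfold globalCost
    simp_rw [hquad]
    refine HasDerivAt.add (HasDerivAt.fun_sum fun k _ => ?_) (HasDerivAt.const_mul _ ?_)
    · have h1 : HasDerivAt (fun t : ℝ => wo k + t • r k) (r k) 0 := by
        simpa using ((hasDerivAt_id (0 : ℝ)).smul_const (r k)).const_add (wo k)
      have h2 := ((hJ k).differentiable (wo k)).hasGradientAt.hasFDerivAt
      have h3 : HasFDerivAt (J k) (innerSL ℝ (gradient (J k) (wo k))) (wo k + (0 : ℝ) • r k) := by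
        rw [zero_smul, add_zero]; exact h2
      exact h3.comp_hasDerivAt (0 : ℝ) h1
    · have h1 := (hasDerivAt_id (0 : ℝ)).mul_const (2 * inner ℝ (stack r) (lapOp M A (stack wo)))
      have h2 := (hasDerivAt_pow 2 (0 : ℝ)).mul_const
        (col r ⬝ᵥ (netLaplacian M A).mulVec (col r))
      exact ((h1.const_add (col wo ⬝ᵥ (netLaplacian M A).mulVec (col wo))).add h2).congr_deriv
        (by simp)
  have hmin : IsLocalMin (fun t : ℝ => globalCost A J η (wo + t • r)) 0 :=
    Eventually.of_forall fun t => by simpa using hwo (Set.mem_univ (wo + t • r))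
  have h0 := hmin.hasDerivAt_eq_zero hder
  have hin : ∑ k, inner ℝ (gradient (J k) (wo k)) (r k) = inner ℝ (stack r) (gradStack J wo) := by
    simp only [PiLp.inner_apply, Fintype.sum_prod_type, gradStack, stack_apply]
    simp [mul_comm]
  have h1 : ‖stack r‖ ^ 2 = 0 := by
    rw [← real_inner_self_eq_norm_sq]
    nth_rewrite 2 [hr']
    rw [inner_add_right, real_inner_smul_right, ← hin]
    linarith
  rw [← hr', ← norm_eq_zero]
  exact pow_eq_zero_iff (n := 2) (by norm_num) |>.1 h1

/-- The error after one noiseless step of the algorithm, as a function of the error `x = wo - W`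
before it. -/
def drift (A : Matrix (Fin N) (Fin N) ℝ) (J : Fin N → Param M → ℝ) (wo : Fin N → Param M)
    (η μ : ℝ) (x : NetSpace N M) : NetSpace N M :=
  stack wo - combOp M A η μ
    (stack (wo - stack.symm x) - μ • gradStack J (wo - stack.symm x))

/-- The operator of the matrix `ℬ_η`. -/
def linOp (A : Matrix (Fin N) (Fin N) ℝ) (J : Fin N → Param M → ℝ) (wo : Fin N → Param M)
    (η μ : ℝ) : NetSpace N M →L[ℝ] NetSpace N M :=
  Matrix.toEuclideanCLM (𝕜 := ℝ) (matB A J wo η μ)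

theorem linOp_eq (A : Matrix (Fin N) (Fin N) ℝ) (J : Fin N → Param M → ℝ) (wo : Fin N → Param M)
    (η μ : ℝ) : linOp A J wo η μ = combOp M A η μ * (1 - μ • hessOp J wo) := by
  rw [linOp, matB, map_mul, map_sub, map_one, map_smul]; rfl

/-- Stationarity of `wo` leaves a bias of second order only: `wo` is a fixed point of the noiseless
algorithm up to `μ² η L ∇J(wo)`. -/
theorem drift_eq (hopt : gradStack J wo + η • lapOp M A (stack wo) = 0) (μ : ℝ)
    (x : NetSpace N M) :
    drift A J wo η μ x = combOp M A η μ
      (x - μ • (gradStack J wo - gradStack J (wo - stack.symm x)))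
      - μ ^ 2 • (η • lapOp M A (gradStack J wo)) := by
  have h1 : combOp M A η μ (stack wo - μ • gradStack J wo)
      = stack wo + μ ^ 2 • (η • lapOp M A (gradStack J wo)) := by
    have h2 : gradStack J wo = -(η • lapOp M A (stack wo)) := eq_neg_of_add_eq_zero_left hopt
    rw [combOp_apply, map_sub, map_smul]
    have h3 : (μ * η) • lapOp M A (stack wo) = -(μ • gradStack J wo) := by
      rw [h2, smul_neg, neg_neg, smul_smul]
    rw [smul_sub, h3]
    module
  have h4 : stack (wo - stack.symm x) = stack wo - x := by
    rw [map_sub, ContinuousLinearEquiv.apply_symm_apply]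
  rw [drift, h4]
  have h5 : stack wo = combOp M A η μ (stack wo - μ • gradStack J wo)
      - μ ^ 2 • (η • lapOp M A (gradStack J wo)) := by rw [h1, add_sub_cancel_right]
  rw [h5, sub_right_comm, ← map_sub, ← h5]
  congr 2
  module

theorem continuous_drift (hJ : ∀ k, StronglyConvexCost (J k) (lmin k) (lmax k)) (μ : ℝ) :
    Continuous (drift A J wo η μ) := by
  have hg : ∀ k, Continuous (gradient (J k)) := fun k => (hJ k).differentiable_gradient.continuous
  have h1 : Continuous fun x : NetSpace N M => wo - stack.symm x :=
    continuous_const.sub stack.symm.continuous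
  have h2 : Continuous (gradStack J) :=
    stack.continuous.comp (continuous_pi fun k => (hg k).comp (continuous_apply k))
  exact continuous_const.sub ((combOp M A η μ).continuous.comp
    ((stack.continuous.comp h1).sub ((h2.comp h1).const_smul μ)))

theorem norm_drift_le (hA : A.IsSymm) (hJ : ∀ k, StronglyConvexCost (J k) (lmin k) (lmax k))
    (hopt : gradStack J wo + η • lapOp M A (stack wo) = 0) {Λ c μ : ℝ}
    (hcomb : CombinationCondition M A η μ) (hΛ : ∀ k, lmax k ≤ Λ) (hΛ0 : 0 ≤ Λ)
    (hc : ∀ k, 2 * c ≤ lmin k) (hμ : 0 ≤ μ) (hμΛ : ∀ k, μ * Λ ^ 2 ≤ lmin k) (hcμ : c * μ ≤ 1)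
    (x : NetSpace N M) : ‖drift A J wo η μ x‖
      ≤ (1 - c * μ) * ‖x‖ + μ ^ 2 * ‖η • lapOp M A (gradStack J wo)‖ := by
  rw [drift_eq hopt]
  refine (norm_sub_le _ _).trans (add_le_add ?_ ?_)
  · refine ((combOp M A η μ).le_of_opNorm_le (norm_combOp_le hA hcomb) _).trans ?_
    rw [one_mul]
    obtain ⟨W, rfl⟩ := stack.surjective x
    rw [ContinuousLinearEquiv.symm_apply_apply, gradStack, gradStack, ← map_sub, ← map_smul,
      ← map_sub]
    refine norm_stack_le_mul (by linarith) fun k => ?_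
    have := (hJ k).norm_gradient_step_sub_le (hΛ k) hΛ0 (hc k) hμ (hμΛ k) hcμ (wo k)
      (wo k - W k)
    rw [sub_sub_cancel] at this
    refine le_of_eq_of_le (congrArg norm ?_) this
    simp only [Pi.sub_apply, Pi.smul_apply]
    module
  · rw [norm_smul, Real.norm_of_nonneg (sq_nonneg μ)]

theorem norm_linOp_le (hA : A.IsSymm) (hJ : ∀ k, StronglyConvexCost (J k) (lmin k) (lmax k))
    {Λ c μ : ℝ} (hcomb : CombinationCondition M A η μ) (hΛ : ∀ k, lmax k ≤ Λ) (hΛ0 : 0 ≤ Λ)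
    (hc : ∀ k, 2 * c ≤ lmin k) (hμ : 0 ≤ μ) (hμΛ : ∀ k, μ * Λ ^ 2 ≤ lmin k) (hcμ : c * μ ≤ 1) :
    ‖linOp A J wo η μ‖ ≤ 1 - c * μ := by
  have h1 : ‖1 - μ • hessOp J wo‖ ≤ 1 - c * μ := by
    refine ContinuousLinearMap.opNorm_le_bound _ (by linarith) fun x => ?_
    obtain ⟨W, rfl⟩ := stack.surjective x
    change ‖stack W - μ • hessOp J wo (stack W)‖ ≤ _
    rw [hessOp_stack, ← map_smul, ← map_sub]
    exact norm_stack_le_mul (by linarith) fun k =>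
      (hJ k).norm_sub_smul_hessian_le (hΛ k) hΛ0 (hc k) hμ (hμΛ k) hcμ (wo k) (W k)
  rw [linOp_eq]
  refine (norm_mul_le _ _).trans ?_
  calc _ ≤ 1 * (1 - c * μ) :=
        mul_le_mul (norm_combOp_le hA hcomb) h1 (norm_nonneg _) zero_le_one
    _ = _ := one_mul _

theorem norm_drift_sub_linOp_le (hA : A.IsSymm)
    (hJ : ∀ k, StronglyConvexCost (J k) (lmin k) (lmax k))
    (hopt : gradStack J wo + η • lapOp M A (stack wo) = 0) {Λ μ κ ε : ℝ}
    (hcomb : CombinationCondition M A η μ) (hΛ : ∀ k, lmax k ≤ Λ) (hΛ0 : 0 ≤ Λ)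
    (hκ : 0 ≤ κ) (hε : 0 < ε) (hH : ∀ k, HessianLipschitzNear (J k) (wo k) κ ε)
    (hμ : 0 ≤ μ) (x : NetSpace N M) : ‖drift A J wo η μ x - linOp A J wo η μ x‖
      ≤ μ * ((κ + 2 * Λ / ε) * ‖x‖ ^ 2) + μ ^ 2 * ‖η • lapOp M A (gradStack J wo)‖ := by
  obtain ⟨W, rfl⟩ := stack.surjective x
  have h1 : drift A J wo η μ (stack W) - linOp A J wo η μ (stack W)
      = -(μ • combOp M A η μ (stack fun k => gradient (J k) (wo k)
          - gradient (J k) (wo k - W k) - hessian (J k) (wo k) (W k)))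
        - μ ^ 2 • (η • lapOp M A (gradStack J wo)) := by
    have e1 : linOp A J wo η μ (stack W)
        = combOp M A η μ (stack W - μ • hessOp J wo (stack W)) := by rw [linOp_eq]; rfl
    have e2 : (stack fun k => gradient (J k) (wo k)
          - gradient (J k) (wo k - W k) - hessian (J k) (wo k) (W k))
        = gradStack J wo - gradStack J (wo - W) - hessOp J wo (stack W) := by
      rw [hessOp_stack, gradStack, gradStack, ← map_sub, ← map_sub]; rfl
    rw [drift_eq hopt, ContinuousLinearEquiv.symm_apply_apply, e1, e2, sub_right_comm, ← map_sub,
      ← map_smul (combOp M A η μ) μ, ← map_neg (combOp M A η μ)]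
    congr 2
    module
  rw [h1]
  refine (norm_sub_le _ _).trans (add_le_add ?_ ?_)
  · rw [norm_neg, norm_smul, Real.norm_of_nonneg hμ]
    refine mul_le_mul_of_nonneg_left ?_ hμ
    refine ((combOp M A η μ).le_of_opNorm_le (norm_combOp_le hA hcomb) _).trans ?_
    rw [one_mul]
    exact norm_stack_le_mul_sq (by positivity) fun k =>
      (hJ k).norm_gradient_linearization_le (hΛ k) hΛ0 hκ hε (hH k) (W k)
  · rw [norm_smul, Real.norm_of_nonneg (sq_nonneg μ)]

end Drift

/-! ### The series and its closed form -/

section Series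
variable {N M : ℕ} {A : Matrix (Fin N) (Fin N) ℝ} {η : ℝ} {J : Fin N → Param M → ℝ}
  {wo : Fin N → Param M}

theorem traceTerm_eq_powerForm (hA : A.IsSymm) (R : Fin N → Matrix (Fin M) (Fin M) ℝ) (μ : ℝ)
    (n : ℕ) : traceTerm A J wo R η μ n
      = ErrorRecursion.powerForm (linOp A J wo η μ) (combOp M A η μ) (blockDiag R) μ n := by
  set B := matB A J wo η μ with hB
  set C := combination M A η μ with hC
  have hG : linOp A J wo η μ ^ n * combOp M A η μ = Matrix.toEuclideanCLM (𝕜 := ℝ) (B ^ n * C) := by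
    rw [map_mul, map_pow]; rfl
  have hcol : ∀ x z, (Matrix.toEuclideanCLM (𝕜 := ℝ) (B ^ n * C) (EuclideanSpace.single x 1)) z
      = (B ^ n * C) z x := by
    intro x z
    change ((B ^ n * C).mulVec (Pi.single x 1)) z = _
    simp
  have htr : B ^ n * (C * blockDiag R * C) * B.transpose ^ n
      = (B ^ n * C) * blockDiag R * (B ^ n * C).transpose := by
    rw [Matrix.transpose_mul, hC, combination_transpose hA, ← hC, Matrix.transpose_pow]
    simp only [Matrix.mul_assoc]
  rw [ErrorRecursion.powerForm, hG, traceTerm, matY, ← hB, ← hC, Matrix.mul_smul, Matrix.smul_mul,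
    Matrix.trace_smul, htr, smul_eq_mul]
  congr 1
  simp only [PiLp.inner_apply, hcol, Matrix.trace, Matrix.diag_apply, Matrix.mul_apply (M := _ * _),
    Matrix.transpose_apply]
  simp only [RCLike.inner_apply, conj_trivial, Finset.mul_sum]
  rw [Finset.sum_comm]
  rw [Finset.sum_comm (s := Finset.univ (α := NetIdx N M)) (t := Finset.univ)
    (f := fun x y => ∑ i, blockDiag R x y * ((B ^ n * C) i y * (B ^ n * C) i x))]
  refine Finset.sum_congr rfl fun y _ => ?_
  rw [Finset.sum_comm]
  refine Finset.sum_congr rfl fun z _ => ?_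
  rw [Matrix.mul_apply, Finset.sum_mul]
  exact Finset.sum_congr rfl fun x _ => by ring

theorem tendsto_pow_of_norm_toEuclideanCLM_lt_one {ι : Type*} [Fintype ι] [DecidableEq ι]
    {B : Matrix ι ι ℝ} (hB : ‖Matrix.toEuclideanCLM (𝕜 := ℝ) B‖ < 1) :
    Tendsto (fun n : ℕ => B ^ n) atTop (𝓝 0) := by
  refine tendsto_pi_nhds.2 fun x => tendsto_pi_nhds.2 fun y => ?_
  have h1 := tendsto_pow_atTop_nhds_zero_of_norm_lt_one hB
  have h2 : Tendsto (fun n : ℕ => (Matrix.toEuclideanCLM (𝕜 := ℝ) B ^ n)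
      (EuclideanSpace.single y 1) x) atTop (𝓝 0) := by
    have hc : Continuous fun T : EuclideanSpace ℝ ι →L[ℝ] EuclideanSpace ℝ ι =>
        T (EuclideanSpace.single y 1) x := by fun_prop
    exact (hc.tendsto' 0 0 rfl).comp h1
  refine h2.congr fun n => ?_
  rw [← map_pow]
  change ((B ^ n).mulVec (Pi.single y 1)) x = _
  simp

/-- The matrix with a given block vectorization. -/
def unbvec (v : BVecIdx N M → ℝ) : Matrix (NetIdx N M) (NetIdx N M) ℝ :=
  Matrix.of fun x y => v ((y.1, x.1), (y.2, x.2))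

theorem blockKron_mulVec_bvec (C D Z : Matrix (NetIdx N M) (NetIdx N M) ℝ) :
    (blockKron C D).mulVec (bvec Z) = bvec (D * Z * C.transpose) := by
  ext ⟨⟨k, m⟩, ⟨a, a'⟩⟩
  have h : ∀ y : BVecIdx N M, blockKron C D ((k, m), (a, a')) y
      = C (k, a) (y.1.1, y.2.1) * D (m, a') (y.1.2, y.2.2) := fun _ => rfl
  simp only [Matrix.mulVec, dotProduct, bvec, h, Matrix.mul_apply, Matrix.transpose_apply,
    Fintype.sum_prod_type, Finset.sum_mul]
  refine Finset.sum_congr rfl fun l _ => ?_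
  rw [Finset.sum_comm]
  refine Finset.sum_congr rfl fun b _ => Finset.sum_congr rfl fun l' _ =>
    Finset.sum_congr rfl fun b' _ => by ring

theorem bvec_dotProduct_bvec (Y Z : Matrix (NetIdx N M) (NetIdx N M) ℝ) :
    bvec Y.transpose ⬝ᵥ bvec Z = (Y * Z).trace := by
  simp only [dotProduct, bvec, Matrix.trace, Matrix.diag_apply, Matrix.mul_apply,
    Matrix.transpose_apply, Fintype.sum_prod_type]
  refine Finset.sum_congr rfl fun l _ => ?_
  rw [Finset.sum_comm]

theorem matF_mulVec_bvec (μ : ℝ) (Z : Matrix (NetIdx N M) (NetIdx N M) ℝ) :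
    (matF A J wo η μ).mulVec (bvec Z)
      = bvec ((matB A J wo η μ).transpose * Z * matB A J wo η μ) := by
  rw [matF, blockKron_mulVec_bvec, Matrix.transpose_transpose]

/-- Iterating the congruence `Z ↦ Bᵀ Z B` sends every matrix to zero. -/
theorem tendsto_congruence_pow {μ : ℝ} (hB : ‖linOp A J wo η μ‖ < 1)
    (Z : Matrix (NetIdx N M) (NetIdx N M) ℝ) :
    Tendsto (fun n : ℕ => (matB A J wo η μ).transpose ^ n * Z * matB A J wo η μ ^ n) atTop
      (𝓝 0) := by
  have h1 := tendsto_pow_of_norm_toEuclideanCLM_lt_one hB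
  have h2 : Tendsto (fun n : ℕ => (matB A J wo η μ).transpose ^ n) atTop (𝓝 0) := by
    have := ((continuous_id.matrix_transpose).tendsto
      (0 : Matrix (NetIdx N M) (NetIdx N M) ℝ)).comp h1
    simpa [Function.comp_def, Matrix.transpose_pow] using this
  simpa using (h2.mul_const Z).mul h1

theorem isUnit_one_sub_matF {μ : ℝ} (hB : ‖linOp A J wo η μ‖ < 1) :
    IsUnit (1 - matF A J wo η μ) := by
  rw [← Matrix.mulVec_injective_iff_isUnit]
  refine (injective_iff_map_eq_zero (Matrix.mulVecLin (1 - matF A J wo η μ))).2 fun v hv => ?_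
  set B := matB A J wo η μ with hBdef
  set Z := unbvec v with hZ
  have hv' : v = bvec Z := rfl
  -- A vector fixed by `ℱ` is a matrix fixed by the congruence.
  have h1 : Z = B.transpose * Z * B := by
    rw [Matrix.mulVecLin_apply, Matrix.sub_mulVec, Matrix.one_mulVec, sub_eq_zero, hv',
      matF_mulVec_bvec] at hv
    exact congrArg unbvec hv
  have h2 : ∀ n : ℕ, B.transpose ^ n * Z * B ^ n = Z := by
    intro n
    induction n with
    | zero => simp
    | succ n ih =>
      calc B.transpose ^ (n + 1) * Z * B ^ (n + 1)
          = B.transpose ^ n * (B.transpose * Z * B) * B ^ n := by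
            rw [pow_succ, pow_succ']; simp only [Matrix.mul_assoc]
        _ = Z := by rw [← h1, ih]
  have h3 : Z = 0 := by
    refine tendsto_nhds_unique ?_ (tendsto_congruence_pow hB Z)
    simp only [← hBdef, h2]
    exact tendsto_const_nhds
  rw [hv', h3]; rfl

/-- With `Z` the solution of `Z - Bᵀ Z B = 1` the partial sums of the series telescope. -/
theorem bvecForm_eq_tsum {μ : ℝ} (hB : ‖linOp A J wo η μ‖ < 1)
    (R : Fin N → Matrix (Fin M) (Fin M) ℝ) (hs : Summable (traceTerm A J wo R η μ)) :
    bvecForm A J wo R η μ = ∑' n, traceTerm A J wo R η μ n := by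
  set B := matB A J wo η μ with hBdef
  set Y := matY A R η μ with hY
  set v := (1 - matF A J wo η μ)⁻¹.mulVec (bvec (1 : Matrix (NetIdx N M) (NetIdx N M) ℝ)) with hv
  set Z := unbvec v with hZ
  have hv' : v = bvec Z := rfl
  have h1 : Z - B.transpose * Z * B = 1 := by
    have h : (1 - matF A J wo η μ).mulVec v = bvec 1 := by
      rw [hv, Matrix.mulVec_mulVec, Matrix.mul_nonsing_inv _
        ((Matrix.isUnit_iff_isUnit_det _).1 (isUnit_one_sub_matF hB)), Matrix.one_mulVec]
    rw [Matrix.sub_mulVec, Matrix.one_mulVec, hv', matF_mulVec_bvec] at h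
    exact congrArg unbvec h
  have hsum : ∀ n : ℕ, ∑ i ∈ Finset.range n, traceTerm A J wo R η μ i
      = (Y * Z).trace - (Y * (B.transpose ^ n * Z * B ^ n)).trace := by
    intro n
    induction n with
    | zero => simp
    | succ n ih =>
      have e1 : traceTerm A J wo R η μ n = (Y * (B.transpose ^ n * 1 * B ^ n)).trace := by
        rw [traceTerm, ← hBdef, ← hY, Matrix.mul_one, Matrix.mul_assoc, Matrix.trace_mul_comm,
          Matrix.mul_assoc]
      have e2 : B.transpose ^ n * 1 * B ^ n = B.transpose ^ n * Z * B ^ n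
          - B.transpose ^ (n + 1) * Z * B ^ (n + 1) := by
        rw [← h1, Matrix.mul_sub, Matrix.sub_mul, pow_succ B.transpose, pow_succ' B]
        simp only [Matrix.mul_assoc]
      rw [Finset.sum_range_succ, ih, e1, e2, Matrix.mul_sub, Matrix.trace_sub]
      ring
  have hlim : Tendsto (fun n : ℕ => (Y * Z).trace - (Y * (B.transpose ^ n * Z * B ^ n)).trace) atTop
      (𝓝 (Y * Z).trace) := by
    have hc : Continuous fun T : Matrix (NetIdx N M) (NetIdx N M) ℝ => (Y * T).trace :=
      (continuous_const.matrix_mul continuous_id).matrix_trace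
    have := ((hc.tendsto 0).comp (tendsto_congruence_pow hB Z)).const_sub (Y * Z).trace
    simpa using this
  have hb : bvecForm A J wo R η μ = (Y * Z).trace := by
    rw [bvecForm, ← hv, hv', ← hY, bvec_dotProduct_bvec]
  rw [hb]
  exact tendsto_nhds_unique hlim (by simpa only [← hsum] using hs.hasSum.tendsto_sum_nat)

end Series

/-! ### Conditional covariance of the gradient noise -/

section Covariance
variable {Ω : Type*} [mΩ : MeasurableSpace Ω] {P : Measure Ω}
  {N M : ℕ} {W : ℕ → Ω → Fin N → Param M} {s : Fin N → ℕ → Param M → Ω → Param M}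
  {β σ : Fin N → ℝ}

/-- Bounded convergence, for convergence in measure to a constant. -/
theorem tendsto_integral_of_tendstoInMeasure_const [IsProbabilityMeasure P] {f : ℕ → Ω → ℝ}
    {r K : ℝ}
    (hf : ∀ i, AEStronglyMeasurable (f i) P) (hK : ∀ i, ∀ᵐ ω ∂P, |f i ω| ≤ K)
    (h : TendstoInMeasure P f atTop fun _ => r) :
    Tendsto (fun i => ∫ ω, f i ω ∂P) atTop (𝓝 r) := by
  refine tendsto_of_subseq_tendsto fun ns hns => ?_
  obtain ⟨ms, -, hms⟩ := (h.comp hns).exists_seq_tendsto_ae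
  refine ⟨ms, ?_⟩
  have := tendsto_integral_of_dominated_convergence (μ := P) (fun _ => K)
    (F := fun n => f (ns (ms n))) (f := fun _ => r) (fun n => hf _) (integrable_const _)
    (fun n => hK _) hms
  simpa using this

theorem abs_apply_le_norm_toEuclideanCLM {ι : Type*} [Fintype ι] [DecidableEq ι]
    (S : Matrix ι ι ℝ) (a b : ι) : |S a b| ≤ ‖Matrix.toEuclideanCLM (𝕜 := ℝ) S‖ := by
  have h1 : (Matrix.toEuclideanCLM (𝕜 := ℝ) S (EuclideanSpace.single b 1)) a = S a b := by
    change (S.mulVec (Pi.single b 1)) a = _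
    simp
  have h2 := (Matrix.toEuclideanCLM (𝕜 := ℝ) S).le_opNorm (EuclideanSpace.single b (1 : ℝ))
  rw [← h1, ← Real.norm_eq_abs]
  refine (PiLp.norm_apply_le _ a).trans (h2.trans (le_of_eq ?_))
  simp

theorem MeasureTheory.MemLp.integrable_coord_mul {f : Ω → Param M} (hf : MemLp f 2 P)
    (a b : Fin M) : Integrable (fun ω => f ω a * f ω b) P := by
  have h : ∀ a, MemLp (fun ω => f ω a) 2 P := fun a =>
    (EuclideanSpace.proj (𝕜 := ℝ) a).comp_memLp' hf
  exact (h a).integrable_mul (h b)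

theorem NoiseSecondOrder.abs_condCov_le [IsProbabilityMeasure P]
    (h : NoiseSecondOrder P W s β σ) (k : Fin N) (i : ℕ) {w : Ω → Param M}
    (hw : Measurable[history W i] w) (hw2 : MemLp w 2 P) (a b : Fin M) :
    ∀ᵐ ω ∂P, |condCov P W s k i w ω a b| ≤ β k ^ 2 * ‖w ω‖ ^ 2 + σ k ^ 2 := by
  have hs := h.memLp k i w hw hw2
  have hab := hs.integrable_coord_mul a b
  have hmono : P[|fun ω => s k (i + 1) (w ω) ω a * s k (i + 1) (w ω) ω b| | history W i]
      ≤ᵐ[P] P[fun ω => ‖s k (i + 1) (w ω) ω‖ ^ 2 | history W i] := by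
    refine condExp_mono hab.abs (integrable_norm_sq hs) (ae_of_all _ fun ω => ?_)
    change |_ * _| ≤ _
    dsimp only
    rw [abs_mul, sq]
    exact mul_le_mul (PiLp.norm_apply_le (s k (i + 1) (w ω) ω) a)
      (PiLp.norm_apply_le (s k (i + 1) (w ω) ω) b) (abs_nonneg _) (norm_nonneg _)
  filter_upwards [abs_condExp_ae_le_condExp_abs (μ := P) (m := history W i)
    (fun ω => s k (i + 1) (w ω) ω a * s k (i + 1) (w ω) ω b), hmono,
    h.second_moment k i w hw hw2] with ω h1 h2 h3
  exact (h1.trans h2).trans h3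

theorem aestronglyMeasurable_condCov (hm : ∀ i, history W i ≤ mΩ) (k : Fin N) (i : ℕ)
    (w : Ω → Param M) (a b : Fin M) :
    AEStronglyMeasurable (fun ω => condCov P W s k i w ω a b) P :=
  (stronglyMeasurable_condExp.mono (hm i)).aestronglyMeasurable

theorem integrable_condCov (k : Fin N) (i : ℕ) (w : Ω → Param M) (a b : Fin M) :
    Integrable (fun ω => condCov P W s k i w ω a b) P :=
  integrable_condExp

theorem integral_condCov [IsProbabilityMeasure P] (hm : ∀ i, history W i ≤ mΩ) (k : Fin N) (i : ℕ)
    (w : Ω → Param M) (a b : Fin M) : ∫ ω, condCov P W s k i w ω a b ∂P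
      = ∫ ω, s k (i + 1) (w ω) ω a * s k (i + 1) (w ω) ω b ∂P :=
  integral_condExp (hm i)

/-- Deviation of the conditional covariance for perturbations of any size: Hölder continuity for
small ones, with the exponent lowered to `t ≤ θ`, and the second-moment bound for large ones. -/
theorem NoiseSecondOrder.abs_condCov_sub_le [IsProbabilityMeasure P]
    (h : NoiseSecondOrder P W s β σ)
    {wo : Fin N → Param M} {κ ε θ t : ℝ} (hκ : 0 ≤ κ) (hε : 0 < ε) (ht : 0 < t) (htθ : t ≤ θ)
    (hsm : NoiseCovSmooth P W s wo κ ε θ) (k : Fin N) (i : ℕ) {w : Ω → Param M}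
    (hw : Measurable[history W i] w) (hw2 : MemLp w 2 P) (a b : Fin M) :
    ∀ᵐ ω ∂P, |condCov P W s k i w ω a b - condCov P W s k i (fun _ => wo k) ω a b|
      ≤ κ * ε ^ (θ - t) * ‖w ω - wo k‖ ^ t
        + (2 * β k ^ 2 + (3 * β k ^ 2 * ‖wo k‖ ^ 2 + 2 * σ k ^ 2) / ε ^ 2)
          * ‖w ω - wo k‖ ^ 2 := by
  have hΔ : Measurable[history W i] fun ω => w ω - wo k := hw.sub_const _
  have hΔ2 : MemLp (fun ω => w ω - wo k) 2 P := hw2.sub (memLp_const _)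
  have e : (fun ω => wo k + (w ω - wo k)) = w := by funext ω; abel
  have hs := hsm k i _ hΔ hΔ2
  rw [e] at hs
  filter_upwards [hs, h.abs_condCov_le k i hw hw2 a b,
    h.abs_condCov_le k i (w := fun _ => wo k) measurable_const (memLp_const _) a b]
    with ω h1 h2 h3
  have p1 : 0 ≤ κ * ε ^ (θ - t) * ‖w ω - wo k‖ ^ t := by positivity
  have p2 : 0 ≤ (3 * β k ^ 2 * ‖wo k‖ ^ 2 + 2 * σ k ^ 2) / ε ^ 2 := by positivity
  -- For large perturbations every constant is bounded by a multiple of `(‖w - wo‖ / ε) ^ 2 ≥ 1`.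
  rcases le_or_gt ‖w ω - wo k‖ ε with hle | hgt
  · have h4 := (abs_apply_le_norm_toEuclideanCLM _ a b).trans (h1 hle)
    rw [Matrix.sub_apply] at h4
    have h5 : ‖w ω - wo k‖ ^ θ ≤ ε ^ (θ - t) * ‖w ω - wo k‖ ^ t := by
      have : ‖w ω - wo k‖ ^ θ = ‖w ω - wo k‖ ^ (θ - t) * ‖w ω - wo k‖ ^ t := by
        rw [← Real.rpow_add_of_nonneg (norm_nonneg _) (by linarith) ht.le, sub_add_cancel]
      rw [this]
      gcongr
    have h6 := mul_le_mul_of_nonneg_left h5 hκ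
    have p3 : 0 ≤ (2 * β k ^ 2 + (3 * β k ^ 2 * ‖wo k‖ ^ 2 + 2 * σ k ^ 2) / ε ^ 2)
      * ‖w ω - wo k‖ ^ 2 := by positivity
    linarith
  · have h4 : ‖w ω‖ ^ 2 ≤ 2 * ‖wo k‖ ^ 2 + 2 * ‖w ω - wo k‖ ^ 2 := by
      have h5 : ‖w ω‖ ≤ ‖wo k‖ + ‖w ω - wo k‖ := norm_le_insert' _ _
      have h6 := pow_le_pow_left₀ (norm_nonneg _) h5 2
      nlinarith [sq_nonneg (‖wo k‖ - ‖w ω - wo k‖)]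
    have h5 : 3 * β k ^ 2 * ‖wo k‖ ^ 2 + 2 * σ k ^ 2
        ≤ (3 * β k ^ 2 * ‖wo k‖ ^ 2 + 2 * σ k ^ 2) / ε ^ 2 * ‖w ω - wo k‖ ^ 2 := by
      rw [div_mul_eq_mul_div, le_div_iff₀ (by positivity)]
      gcongr
    have h6 := mul_le_mul_of_nonneg_left h4 (sq_nonneg (β k))
    have h7 := abs_sub (condCov P W s k i w ω a b) (condCov P W s k i (fun _ => wo k) ω a b)
    linarith

/-- A fractional power, bounded by a quadratic at the scale `μ`. -/
theorem rpow_le_rpow_mul_one_add {μ d t : ℝ} (hμ : 0 < μ) (hd : 0 ≤ d) (ht : 0 ≤ t) (ht1 : t ≤ 1) :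
    d ^ t ≤ μ ^ (t / 2) * (1 + d ^ 2 / μ) := by
  -- `x ^ (t / 2)` is at most `1` for `x ≤ 1` and at most `x` otherwise, where `x = d ^ 2 / μ`.
  rcases le_total (d ^ 2) μ with hle | hge
  · have h1 : d ^ t = (d ^ 2) ^ (t / 2) := by
      rw [← Real.rpow_natCast d 2, ← Real.rpow_mul hd]; congr 1; push_cast; ring
    rw [h1]
    calc (d ^ 2) ^ (t / 2) ≤ μ ^ (t / 2) * 1 := by
          rw [mul_one]; exact Real.rpow_le_rpow (sq_nonneg d) hle (by linarith)
      _ ≤ _ := by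
          gcongr
          have : 0 ≤ d ^ 2 / μ := by positivity
          linarith
  · have h1 : d ^ t = μ ^ (t / 2) * (d ^ 2 / μ) ^ (t / 2) := by
      rw [← Real.mul_rpow hμ.le (by positivity), mul_div_cancel₀ _ hμ.ne',
        ← Real.rpow_natCast d 2, ← Real.rpow_mul hd]
      congr 1; push_cast; ring
    rw [h1]
    gcongr
    have h2 : 1 ≤ d ^ 2 / μ := (one_le_div hμ).2 hge
    calc (d ^ 2 / μ) ^ (t / 2) ≤ (d ^ 2 / μ) ^ (1 : ℝ) :=
          Real.rpow_le_rpow_of_exponent_le h2 (by linarith)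
      _ ≤ _ := by rw [Real.rpow_one]; linarith

/-- If the mean-square error of an agent is eventually of order `μ`, then the second moments of its
noise are eventually close to the limiting covariance. -/
theorem NoiseSecondOrder.eventually_abs_integral_sub_le [IsProbabilityMeasure P]
    (h : NoiseSecondOrder P W s β σ)
    (hm : ∀ i, history W i ≤ mΩ) (hW : ∀ i, Measurable[history W i] (W i))
    {wo : Fin N → Param M} {κ ε θ t : ℝ} (hκ : 0 ≤ κ) (hε : 0 < ε) (ht : 0 < t) (ht1 : t ≤ 1)
    (htθ : t ≤ θ) (hsm : NoiseCovSmooth P W s wo κ ε θ) {R : Fin N → Matrix (Fin M) (Fin M) ℝ}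
    (hR : NoiseCovLimit P W s wo R) (k : Fin N) (hW2 : ∀ i, MemLp (fun ω => W i ω k) 2 P)
    {μ K : ℝ} (hμ : 0 < μ) (hμ1 : μ ≤ 1)
    (hK : ∀ᶠ i in atTop, ∫ ω, ‖W i ω k - wo k‖ ^ 2 ∂P ≤ K * μ) (a b : Fin M) :
    ∀ᶠ i in atTop, |∫ ω, s k (i + 1) (W i ω k) ω a * s k (i + 1) (W i ω k) ω b ∂P - R k a b|
      ≤ (κ * ε ^ (θ - t) * (1 + K)
        + (2 * β k ^ 2 + (3 * β k ^ 2 * ‖wo k‖ ^ 2 + 2 * σ k ^ 2) / ε ^ 2) * K + 1)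
        * μ ^ (t / 2) := by
  have hlim : Tendsto (fun i => ∫ ω, condCov P W s k i (fun _ => wo k) ω a b ∂P) atTop
      (𝓝 (R k a b)) :=
    tendsto_integral_of_tendstoInMeasure_const
      (fun i => aestronglyMeasurable_condCov hm k i _ a b)
      (fun i => h.abs_condCov_le k i measurable_const (memLp_const _) a b) (hR k a b)
  have hpos : 0 < μ ^ (t / 2) := Real.rpow_pos_of_pos hμ _
  have hμt : μ ≤ μ ^ (t / 2) := by
    simpa using Real.rpow_le_rpow_of_exponent_ge hμ hμ1 (by linarith : t / 2 ≤ 1)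
  filter_upwards [hK, Metric.tendsto_nhds.1 hlim _ hpos] with i hi hlim_i
  rw [Real.dist_eq] at hlim_i
  set L₁ := κ * ε ^ (θ - t) with hL₁
  set L₂ := 2 * β k ^ 2 + (3 * β k ^ 2 * ‖wo k‖ ^ 2 + 2 * σ k ^ 2) / ε ^ 2 with hL₂
  have p1 : 0 ≤ L₁ := by positivity
  have p2 : 0 ≤ L₂ := by positivity
  have hw : Measurable[history W i] fun ω => W i ω k := (measurable_pi_apply k).comp (hW i)
  have hsq : Integrable (fun ω => ‖W i ω k - wo k‖ ^ 2) P :=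
    integrable_norm_sq ((hW2 i).sub (memLp_const _))
  have i1 : Integrable (fun ω => L₁ * μ ^ (t / 2) * (1 + ‖W i ω k - wo k‖ ^ 2 / μ)) P :=
    ((integrable_const _).add (hsq.div_const μ)).const_mul _
  have i0 : Integrable (fun ω => condCov P W s k i (fun ω => W i ω k) ω a b
      - condCov P W s k i (fun _ => wo k) ω a b) P :=
    (integrable_condCov k i _ a b).sub (integrable_condCov k i _ a b)
  have hK0 : 0 ≤ K * μ := (integral_nonneg fun ω => by positivity).trans hi
  have hK0' : 0 ≤ K := nonneg_of_mul_nonneg_left hK0 hμ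
  have hdev : |∫ ω, condCov P W s k i (fun ω => W i ω k) ω a b ∂P
      - ∫ ω, condCov P W s k i (fun _ => wo k) ω a b ∂P|
      ≤ L₁ * μ ^ (t / 2) * (1 + K) + L₂ * (K * μ) := by
    rw [← integral_sub (integrable_condCov k i _ a b) (integrable_condCov k i _ a b)]
    calc _ ≤ ∫ ω, |condCov P W s k i (fun ω => W i ω k) ω a b
          - condCov P W s k i (fun _ => wo k) ω a b| ∂P := abs_integral_le_integral_abs
      _ ≤ ∫ ω, (L₁ * μ ^ (t / 2) * (1 + ‖W i ω k - wo k‖ ^ 2 / μ)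
            + L₂ * ‖W i ω k - wo k‖ ^ 2) ∂P := by
          refine integral_mono_ae i0.abs (i1.add (hsq.const_mul _)) ?_
          filter_upwards [h.abs_condCov_sub_le hκ hε ht htθ hsm k i hw (hW2 i) a b] with ω hω
          refine hω.trans (add_le_add ?_ le_rfl)
          rw [mul_assoc L₁]
          exact mul_le_mul_of_nonneg_left
            (rpow_le_rpow_mul_one_add hμ (norm_nonneg _) ht.le ht1) p1
      _ = L₁ * μ ^ (t / 2) * (1 + (∫ ω, ‖W i ω k - wo k‖ ^ 2 ∂P) / μ)
            + L₂ * ∫ ω, ‖W i ω k - wo k‖ ^ 2 ∂P := by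
          rw [integral_add i1 (hsq.const_mul _), integral_const_mul, integral_const_mul,
            integral_add (integrable_const _) (hsq.div_const μ), integral_div]
          simp
      _ ≤ _ := by
          gcongr
          rwa [div_le_iff₀ hμ]
  rw [← integral_condCov hm k i (fun ω => W i ω k) a b]
  calc _ ≤ (L₁ * μ ^ (t / 2) * (1 + K) + L₂ * (K * μ)) + μ ^ (t / 2) :=
        (abs_sub_le _ _ _).trans (add_le_add hdev hlim_i.le)
    _ ≤ (L₁ * μ ^ (t / 2) * (1 + K) + L₂ * (K * μ ^ (t / 2))) + μ ^ (t / 2) := by gcongr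
    _ = _ := by ring

end Covariance

/-! ### The iterates as an error recursion -/

section Iterates
variable {Ω : Type*} {N M : ℕ}
  {A : Matrix (Fin N) (Fin N) ℝ} {η μ : ℝ} {J : Fin N → Param M → ℝ} {lmin lmax : Fin N → ℝ}
  {wo : Fin N → Param M} {g : Fin N → ℕ → Param M → Ω → Param M} {w₀ : Ω → Fin N → Param M}
  {β σ β' σ' : Fin N → ℝ}

theorem measurable_history (W : ℕ → Ω → Fin N → Param M) (i : ℕ) :
    Measurable[history W i] (W i) :=
  (comap_measurable (W i)).mono (le_iSup₂_of_le i le_rfl le_rfl) le_rfl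

theorem history_mono (W : ℕ → Ω → Fin N → Param M) : Monotone (history W) := fun _ j hij =>
  iSup₂_le fun l hl => le_iSup₂_of_le (f := fun (j' : ℕ) (_ : j' ≤ j) =>
    MeasurableSpace.comap (W j') inferInstance) l (hl.trans hij) le_rfl

/-- The gradient noises of all agents at the current iterates, stacked. -/
def noiseStack (J : Fin N → Param M → ℝ) (g : Fin N → ℕ → Param M → Ω → Param M)
    (W : ℕ → Ω → Fin N → Param M) (i : ℕ) (ω : Ω) : NetSpace N M :=
  stack fun k => gradNoise J g k (i + 1) (W i ω k) ω

theorem stack_iterates_succ (J : Fin N → Param M → ℝ) (i : ℕ) (ω : Ω) :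
    stack (iterates A η μ g w₀ (i + 1) ω) = combOp M A η μ (stack (iterates A η μ g w₀ i ω)
      - μ • gradStack J (iterates A η μ g w₀ i ω)
      + μ • noiseStack J g (iterates A η μ g w₀) i ω) := by
  have e : stack (iterates A η μ g w₀ i ω) - μ • gradStack J (iterates A η μ g w₀ i ω)
      + μ • noiseStack J g (iterates A η μ g w₀) i ω
      = stack (adaptStep μ (fun k w => g k (i + 1) w ω) (iterates A η μ g w₀ i ω)) := by
    rw [gradStack, noiseStack, ← map_smul, ← map_smul, ← map_sub, ← map_add]
    congr 1
    funext k
    simp only [Pi.add_apply, Pi.sub_apply, Pi.smul_apply, gradNoise, adaptStep]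
    module
  rw [e, combOp_stack]
  rfl

variable [mΩ : MeasurableSpace Ω] {P : Measure Ω}

theorem history_le {W : ℕ → Ω → Fin N → Param M} (hW : ∀ i, Measurable (W i)) (i : ℕ) :
    history W i ≤ mΩ :=
  iSup₂_le fun j _ => (hW j).comap_le

theorem measurable_iterates (hg : ∀ k i, Measurable (fun p : Param M × Ω => g k i p.1 p.2))
    (hw₀ : Measurable w₀) (i : ℕ) : Measurable (iterates A η μ g w₀ i) := by
  induction i with
  | zero => exact hw₀
  | succ i ih =>
    have h1 : Measurable fun ω => adaptStep μ (fun k w => g k (i + 1) w ω)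
        (iterates A η μ g w₀ i ω) := by
      refine measurable_pi_lambda _ fun k => ?_
      have hk : Measurable fun ω => iterates A η μ g w₀ i ω k := (measurable_pi_apply k).comp ih
      exact hk.sub (((hg k (i + 1)).comp (hk.prodMk measurable_id)).const_smul μ)
    have h2 : Continuous (combineStep (M := M) A η μ) := by
      have e : combineStep (M := M) A η μ = fun ψ => stack.symm (combOp M A η μ (stack ψ)) := by
        funext ψ
        rw [combOp_stack, ContinuousLinearEquiv.symm_apply_apply]
      rw [e]
      exact stack.symm.continuous.comp ((combOp M A η μ).continuous.comp stack.continuous)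
    exact h2.measurable.comp h1

theorem memLp_stack {p : ENNReal} {U : Ω → Fin N → Param M}
    (h : ∀ k, MemLp (fun ω => U ω k) p P) : MemLp (fun ω => stack (U ω)) p P :=
  (stack : (Fin N → Param M) ≃L[ℝ] NetSpace N M).toContinuousLinearMap.comp_memLp'
    (memLp_pi_iff.2 h)

theorem MeasureTheory.MemLp.of_stack {p : ENNReal} {U : Ω → Fin N → Param M}
    (h : MemLp (fun ω => stack (U ω)) p P) (k : Fin N) : MemLp (fun ω => U ω k) p P :=
  memLp_pi_iff.1 ((stack : (Fin N → Param M) ≃L[ℝ] NetSpace N M).symm.toContinuousLinearMap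
    |>.comp_memLp' h) k

/-- The gradient grows at most linearly, so it preserves integrability. -/
theorem memLp_gradient [IsProbabilityMeasure P] {f : Param M → ℝ} {l L : ℝ}
    (hf : StronglyConvexCost f l L) {p : ENNReal} {w : Ω → Param M} (hw : MemLp w p P) :
    MemLp (fun ω => gradient f (w ω)) p P := by
  have h1 : MemLp (fun ω => gradient f (w ω) - gradient f 0) p P := by
    refine hw.of_le_mul (c := |L|)
      ((hf.differentiable_gradient.continuous.comp_aestronglyMeasurable hw.1).sub
        aestronglyMeasurable_const) (ae_of_all _ fun ω => ?_)
    simpa using hf.norm_gradient_sub_le (le_abs_self L) (abs_nonneg L) (w ω) 0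
  refine (h1.add (memLp_const (gradient f 0))).congr_norm
    (hf.differentiable_gradient.continuous.comp_aestronglyMeasurable hw.1)
    (ae_of_all _ fun ω => ?_)
  rw [Pi.add_apply, sub_add_cancel]

theorem memLp_iterates [IsProbabilityMeasure P]
    (hJ : ∀ k, StronglyConvexCost (J k) (lmin k) (lmax k))
    (hw₀ : ∀ k, MemLp (fun ω => w₀ ω k) 4 P)
    (h4 : NoiseFourthOrder P (iterates A η μ g w₀) (gradNoise J g) β' σ') (i : ℕ) :
    ∀ k, MemLp (fun ω => iterates A η μ g w₀ i ω k) 4 P := by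
  induction i with
  | zero => exact hw₀
  | succ i ih =>
    have hnoise : MemLp (noiseStack J g (iterates A η μ g w₀) i) 4 P :=
      memLp_stack fun k => h4.memLp k i _
        ((measurable_pi_apply k).comp (measurable_history _ i)) (ih k)
    have hgrad : MemLp (fun ω => gradStack J (iterates A η μ g w₀ i ω)) 4 P :=
      memLp_stack fun k => memLp_gradient (hJ k) (ih k)
    refine MeasureTheory.MemLp.of_stack ?_
    simp_rw [stack_iterates_succ J]
    exact (combOp M A η μ).comp_memLp'
      (((memLp_stack ih).sub (hgrad.const_smul μ)).add (hnoise.const_smul μ))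

theorem condExp_noiseStack [IsProbabilityMeasure P] {W : ℕ → Ω → Fin N → Param M}
    (hW : ∀ i k, MemLp (fun ω => W i ω k) 4 P)
    (h2 : NoiseSecondOrder P W (gradNoise J g) β σ) (i : ℕ) :
    P[noiseStack J g W i | history W i] =ᵐ[P] fun _ => 0 := by
  have hw : ∀ k, Measurable[history W i] fun ω => W i ω k := fun k =>
    (measurable_pi_apply k).comp (measurable_history W i)
  let T : Fin N → Param M →L[ℝ] NetSpace N M := fun k =>
    (stack : (Fin N → Param M) ≃L[ℝ] NetSpace N M).toContinuousLinearMap.comp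
      (ContinuousLinearMap.single ℝ (fun _ => Param M) k)
  have hs : ∀ k, Integrable (fun ω => gradNoise J g k (i + 1) (W i ω k) ω) P := fun k =>
    (h2.memLp k i _ (hw k) (hW i k).two_of_four).integrable (by norm_num)
  have e : noiseStack J g W i
      = ∑ k, fun ω => T k (gradNoise J g k (i + 1) (W i ω k) ω) := by
    funext ω
    rw [Finset.sum_apply]
    change _ = ∑ k, stack (Pi.single k (gradNoise J g k (i + 1) (W i ω k) ω))
    rw [← map_sum, Finset.univ_sum_single fun k => gradNoise J g k (i + 1) (W i ω k) ω]
    rfl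
  rw [e]
  have hz : ∀ k, P[fun ω => T k (gradNoise J g k (i + 1) (W i ω k) ω) | history W i]
      =ᵐ[P] fun _ => 0 := by
    intro k
    refine ((T k).comp_condExp_comm (hs k)).symm.trans ?_
    filter_upwards [h2.mean_zero k i _ (hw k) (hW i k).two_of_four] with ω hω
    rw [Function.comp_apply, hω, map_zero]
  refine (condExp_finsetSum (fun k _ => (T k).integrable_comp (hs k)) _).trans ?_
  filter_upwards [ae_all_iff.2 hz] with ω hω
  rw [Finset.sum_apply]
  exact Finset.sum_eq_zero fun k _ => hω k

theorem integral_noiseStack_pow_four_le [IsProbabilityMeasure P] {W : ℕ → Ω → Fin N → Param M}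
    (hm : ∀ i, history W i ≤ mΩ) (hW : ∀ i k, MemLp (fun ω => W i ω k) 4 P)
    (h4 : NoiseFourthOrder P W (gradNoise J g) β' σ') (wo : Fin N → Param M) (i : ℕ) :
    ∫ ω, ‖noiseStack J g W i ω‖ ^ 4 ∂P
      ≤ (N * ∑ k, (β' k ^ 4 * (8 * (‖wo k‖ ^ 4 + 1)) + σ' k ^ 4))
        * (1 + ∫ ω, ‖stack (wo - W i ω)‖ ^ 4 ∂P) := by
  have hw : ∀ k, Measurable[history W i] fun ω => W i ω k := fun k =>
    (measurable_pi_apply k).comp (measurable_history W i)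
  have hs : ∀ k, MemLp (fun ω => gradNoise J g k (i + 1) (W i ω k) ω) 4 P := fun k =>
    h4.memLp k i _ (hw k) (hW i k)
  have hX : Integrable (fun ω => ‖stack (wo - W i ω)‖ ^ 4) P :=
    integrable_norm_pow_four (memLp_stack fun k => (memLp_const (wo k)).sub (hW i k))
  set m := ∫ ω, ‖stack (wo - W i ω)‖ ^ 4 ∂P with hm'
  have hm0 : 0 ≤ m := integral_nonneg fun ω => by positivity
  have hk : ∀ k, ∫ ω, ‖gradNoise J g k (i + 1) (W i ω k) ω‖ ^ 4 ∂P
      ≤ (β' k ^ 4 * (8 * (‖wo k‖ ^ 4 + 1)) + σ' k ^ 4) * (1 + m) := by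
    intro k
    have hβ : 0 ≤ β' k ^ 4 := by positivity
    have hσ : 0 ≤ σ' k ^ 4 := by positivity
    have i1 : Integrable (fun ω => β' k ^ 4 * (8 * (‖wo k‖ ^ 4 + ‖stack (wo - W i ω)‖ ^ 4))) P :=
      (((integrable_const _).add hX).const_mul _).const_mul _
    rw [← integral_condExp (hm i)]
    calc _ ≤ ∫ ω, (β' k ^ 4 * (8 * (‖wo k‖ ^ 4 + ‖stack (wo - W i ω)‖ ^ 4)) + σ' k ^ 4) ∂P := by
          refine integral_mono_ae integrable_condExp (i1.add (integrable_const _)) ?_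
          filter_upwards [h4.fourth_moment k i _ (hw k) (hW i k)] with ω hω
          refine hω.trans (add_le_add_left (mul_le_mul_of_nonneg_left ?_ hβ) _)
          have e1 : ‖W i ω k‖ ≤ ‖wo k‖ + ‖stack (wo - W i ω)‖ := by
            refine (norm_le_insert (wo k) (W i ω k)).trans ?_
            gcongr
            exact norm_le_norm_stack (wo - W i ω) k
          have e2 := pow_le_pow_left₀ (norm_nonneg _) e1 4
          refine e2.trans ?_
          simpa using add_pow_le (norm_nonneg (wo k)) (norm_nonneg (stack (wo - W i ω))) 4 |>.trans
            (by norm_num)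
      _ = β' k ^ 4 * (8 * (‖wo k‖ ^ 4 + m)) + σ' k ^ 4 := by
          rw [integral_add i1 (integrable_const _), integral_const_mul, integral_const_mul,
            integral_add (integrable_const _) hX]
          simp [hm']
      _ ≤ _ := by
          have : 0 ≤ ‖wo k‖ ^ 4 * m := by positivity
          have h1 : 8 * (‖wo k‖ ^ 4 + m) ≤ 8 * (‖wo k‖ ^ 4 + 1) * (1 + m) := by nlinarith
          have h2 := mul_le_mul_of_nonneg_left h1 hβ
          have h3 := mul_nonneg hσ hm0
          linarith
  calc ∫ ω, ‖noiseStack J g W i ω‖ ^ 4 ∂P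
      ≤ ∫ ω, N * ∑ k, ‖gradNoise J g k (i + 1) (W i ω k) ω‖ ^ 4 ∂P := by
        refine integral_mono (integrable_norm_pow_four (memLp_stack hs))
          ((integrable_finsetSum _ fun k _ => integrable_norm_pow_four (hs k)).const_mul _)
          fun ω => ?_
        have h1 : ‖noiseStack J g W i ω‖ ^ 4
            = (∑ k, ‖gradNoise J g k (i + 1) (W i ω k) ω‖ ^ 2) ^ 2 := by
          rw [← norm_stack_sq, noiseStack]; ring
        have h2 := sq_sum_le_card_mul_sum_sq (s := Finset.univ)
          (f := fun k => ‖gradNoise J g k (i + 1) (W i ω k) ω‖ ^ 2)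
        dsimp only
        rw [h1]
        refine h2.trans (le_of_eq ?_)
        simp only [← pow_mul, Finset.card_univ, Fintype.card_fin]
    _ = N * ∑ k, ∫ ω, ‖gradNoise J g k (i + 1) (W i ω k) ω‖ ^ 4 ∂P := by
        rw [integral_const_mul, integral_finsetSum _ fun k _ => integrable_norm_pow_four (hs k)]
    _ ≤ N * ∑ k, (β' k ^ 4 * (8 * (‖wo k‖ ^ 4 + 1)) + σ' k ^ 4) * (1 + m) := by
        gcongr with k
        exact hk k
    _ = _ := by rw [← Finset.sum_mul, mul_assoc]

/-- The second moments of the stacked noise approach the diagonal block matrix of the limiting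
covariances: the off-diagonal blocks vanish since distinct agents are uncorrelated. -/
theorem eventually_sum_abs_noiseStack_le [IsProbabilityMeasure P] {W : ℕ → Ω → Fin N → Param M}
    (hm : ∀ i, history W i ≤ mΩ) (hW : ∀ i k, MemLp (fun ω => W i ω k) 4 P)
    (h2 : NoiseSecondOrder P W (gradNoise J g) β σ)
    {κ ε θ t : ℝ} (hκ : 0 ≤ κ) (hε : 0 < ε) (ht : 0 < t) (ht1 : t ≤ 1)
    (htθ : t ≤ θ) (hsm : NoiseCovSmooth P W (gradNoise J g) wo κ ε θ)
    {R : Fin N → Matrix (Fin M) (Fin M) ℝ} (hR : NoiseCovLimit P W (gradNoise J g) wo R)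
    {K : ℝ} (hμ : 0 < μ) (hμ1 : μ ≤ 1)
    (hK : ∀ᶠ i in atTop, ∫ ω, ‖stack (wo - W i ω)‖ ^ 2 ∂P ≤ K * μ) :
    ∀ᶠ i in atTop, ∑ x, ∑ y, |∫ ω, noiseStack J g W i ω x * noiseStack J g W i ω y ∂P
        - blockDiag R x y|
      ≤ (∑ x : NetIdx N M, ∑ _y : NetIdx N M, (κ * ε ^ (θ - t) * (1 + K)
        + (2 * β x.1 ^ 2 + (3 * β x.1 ^ 2 * ‖wo x.1‖ ^ 2 + 2 * σ x.1 ^ 2) / ε ^ 2) * K + 1))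
        * μ ^ (t / 2) := by
  have hX : ∀ i, Integrable (fun ω => ‖stack (wo - W i ω)‖ ^ 2) P := fun i =>
    integrable_norm_sq
      (memLp_stack fun k => ((memLp_const (wo k)).sub (hW i k)).two_of_four)
  have hk : ∀ (k : Fin N) (a b : Fin M), _ := fun k a b =>
    h2.eventually_abs_integral_sub_le hm (measurable_history W) hκ hε ht ht1 htθ hsm hR k
      (fun i => (hW i k).two_of_four) hμ hμ1 (K := K) (by
        filter_upwards [hK] with i hi
        refine le_trans ?_ hi
        refine integral_mono
          (integrable_norm_sq ((hW i k).two_of_four.sub (memLp_const (wo k)))) (hX i) fun ω => ?_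
        rw [norm_sub_rev]
        exact pow_le_pow_left₀ (norm_nonneg _) (norm_le_norm_stack (wo - W i ω) k) 2) a b
  filter_upwards [eventually_all.2 fun k => eventually_all.2 fun a => eventually_all.2 fun b =>
    hk k a b, hK] with i hi hKi
  have hK0 : 0 ≤ K := by
    have : 0 ≤ K * μ := (integral_nonneg fun ω => by positivity).trans hKi
    exact nonneg_of_mul_nonneg_left this hμ
  rw [Finset.sum_mul]
  refine Finset.sum_le_sum fun x _ => ?_
  rw [Finset.sum_mul]
  refine Finset.sum_le_sum fun y _ => ?_
  obtain ⟨k, a⟩ := x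
  obtain ⟨l, b⟩ := y
  simp only [noiseStack, stack_apply, blockDiag, Matrix.of_apply]
  by_cases hkl : k = l
  · subst hkl
    rw [if_pos rfl]
    exact hi k a b
  · rw [if_neg hkl, sub_zero, integral_condExp_eq_zero (hm i) (h2.uncorrelated k l i hkl a b),
      abs_zero]
    positivity

/-- The stacked error of the iterates satisfies the recursion, with constants `c`, `b` and `K` that do
not depend on the step-size. -/
theorem errorRecursion_iterates [IsProbabilityMeasure P] (hA : A.IsSymm)
    (hJ : ∀ k, StronglyConvexCost (J k) (lmin k) (lmax k))
    (hopt : gradStack J wo + η • lapOp M A (stack wo) = 0)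
    {κ ε : ℝ} (hκ : 0 ≤ κ) (hε : 0 < ε) (hH : ∀ k, HessianLipschitzNear (J k) (wo k) κ ε)
    (hg : ∀ k i, Measurable (fun p : Param M × Ω => g k i p.1 p.2)) (hw₀ : Measurable w₀)
    (hw₀' : ∀ k, MemLp (fun ω => w₀ ω k) 4 P) (hcomb : CombinationCondition M A η μ)
    (h2 : NoiseSecondOrder P (iterates A η μ g w₀) (gradNoise J g) β σ)
    (h4 : NoiseFourthOrder P (iterates A η μ g w₀) (gradNoise J g) β' σ')
    {Λ c : ℝ} (hΛ : ∀ k, lmax k ≤ Λ) (hΛ0 : 0 ≤ Λ) (hc : ∀ k, 2 * c ≤ lmin k) (hμ : 0 ≤ μ)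
    (hμΛ : ∀ k, μ * Λ ^ 2 ≤ lmin k) (hcμ : c * μ ≤ 1) :
    ErrorRecursion P (history (iterates A η μ g w₀))
      (fun i ω => stack (wo - iterates A η μ g w₀ i ω))
      (noiseStack J g (iterates A η μ g w₀)) (drift A J wo η μ) (linOp A J wo η μ) (combOp M A η μ)
      μ c ‖η • lapOp M A (gradStack J wo)‖
      ((κ + 2 * Λ / ε) + N * ∑ k, (β' k ^ 4 * (8 * (‖wo k‖ ^ 4 + 1)) + σ' k ^ 4)) := by
  have hm := history_le fun i => measurable_iterates (A := A) (η := η) (μ := μ) hg hw₀ i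
  have hW := memLp_iterates hJ hw₀' h4
  have hK1 : 0 ≤ κ + 2 * Λ / ε := by positivity
  have hK2 : 0 ≤ (N : ℝ) * ∑ k, (β' k ^ 4 * (8 * (‖wo k‖ ^ 4 + 1)) + σ' k ^ 4) := by
    refine mul_nonneg (Nat.cast_nonneg _) (Finset.sum_nonneg fun k _ => ?_)
    positivity
  exact
    { le := hm
      mono := history_mono _
      adapted := fun i => stack.continuous.measurable.comp
        (measurable_const.sub (measurable_history _ i))
      memLp_error := fun i => memLp_stack fun k => (memLp_const (wo k)).sub (hW i k)
      memLp_noise := fun i => memLp_stack fun k => h4.memLp k i _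
        ((measurable_pi_apply k).comp (measurable_history _ i)) (hW i k)
      noise_mean := condExp_noiseStack hW h2
      noise_fourth := fun i => by
        refine (integral_noiseStack_pow_four_le hm hW h4 wo i).trans ?_
        refine mul_le_mul_of_nonneg_right (le_add_of_nonneg_left hK1) ?_
        have : 0 ≤ ∫ ω, ‖stack (wo - iterates A η μ g w₀ i ω)‖ ^ 4 ∂P :=
          integral_nonneg fun ω => by positivity
        linarith
      step := fun i ω => by
        rw [drift, ContinuousLinearEquiv.symm_apply_apply, sub_sub_cancel, map_sub,
          stack_iterates_succ J, map_add, map_smul (combOp M A η μ) μ (noiseStack _ _ _ _ _),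
          sub_sub]
      continuous := continuous_drift hJ μ
      norm_comb := norm_combOp_le hA hcomb
      norm_linear := norm_linOp_le hA hJ hcomb hΛ hΛ0 hc hμ hμΛ hcμ
      contract := norm_drift_le hA hJ hopt hcomb hΛ hΛ0 hc hμ hμΛ hcμ
      linearize := fun x => by
        refine (norm_drift_sub_linOp_le hA hJ hopt hcomb hΛ hΛ0 hκ hε hH hμ x).trans ?_
        refine add_le_add (mul_le_mul_of_nonneg_left ?_ hμ) le_rfl
        exact mul_le_mul_of_nonneg_right (le_add_of_nonneg_right hK2) (sq_nonneg _) }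

end Iterates

/-! ### The steady-state mean-square error -/

theorem abs_limsup_sub_le {u : ℕ → ℝ} {a r : ℝ} (h : ∀ᶠ i in atTop, |u i - a| ≤ r) :
    |limsup u atTop - a| ≤ r := by
  have hup : ∀ᶠ i in atTop, u i ≤ a + r := h.mono fun i hi => by linarith [(abs_le.1 hi).2]
  have hlo : ∀ᶠ i in atTop, a - r ≤ u i := h.mono fun i hi => by linarith [(abs_le.1 hi).1]
  have hb : IsBoundedUnder (· ≤ ·) atTop u := ⟨a + r, by simpa using hup⟩
  have hc : IsCoboundedUnder (· ≤ ·) atTop u :=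
    IsBoundedUnder.isCoboundedUnder_le ⟨a - r, by simpa using hlo⟩
  rw [abs_le]
  constructor
  · have := le_limsup_of_frequently_le hlo.frequently hb
    linarith
  · have := limsup_le_of_le hc hup
    linarith

theorem bddAbove_range_of_eventually_le {u : ℕ → ℝ} {r : ℝ} (h : ∀ᶠ i in atTop, u i ≤ r) :
    BddAbove (Set.range u) :=
  IsBoundedUnder.bddAbove_range ⟨r, by simpa using h⟩

/-- The estimate behind both expansions: for small step-sizes the mean-square error is eventually
within `O(μ ^ (1 + t / 2))` of the sum of the series, for every `t ≤ min 1 θ`. -/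
theorem eventually_abs_meanSquareError_sub_le {Ω : Type*} [MeasurableSpace Ω] (P : Measure Ω)
    [IsProbabilityMeasure P] {N M : ℕ} {A : Matrix (Fin N) (Fin N) ℝ} (hA : IsNetwork A) {η : ℝ}
    {J : Fin N → Param M → ℝ} {lmin lmax : Fin N → ℝ}
    (hJ : ∀ k, StronglyConvexCost (J k) (lmin k) (lmax k))
    {wo : Fin N → Param M} (hwo : IsMinOn (globalCost A J η) Set.univ wo)
    {κH εH : ℝ} (hκH : 0 ≤ κH) (hεH : 0 < εH)
    (hH : ∀ k, HessianLipschitzNear (J k) (wo k) κH εH)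
    {g : Fin N → ℕ → Param M → Ω → Param M}
    (hg : ∀ k i, Measurable (fun p : Param M × Ω => g k i p.1 p.2))
    {w₀ : ℝ → Ω → Fin N → Param M} (hw₀ : ∀ μ, Measurable (w₀ μ))
    (hw₀' : ∀ μ k, MemLp (fun ω => w₀ μ ω k) 4 P)
    {μmax : ℝ} (hμmax : 0 < μmax)
    (hcomb : ∀ μ ∈ Set.Ioo 0 μmax, CombinationCondition M A η μ)
    {β σ β' σ' : Fin N → ℝ}
    (hnoise2 : ∀ μ ∈ Set.Ioo 0 μmax,
      NoiseSecondOrder P (iterates A η μ g (w₀ μ)) (gradNoise J g) β σ)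
    (hnoise4 : ∀ μ ∈ Set.Ioo 0 μmax,
      NoiseFourthOrder P (iterates A η μ g (w₀ μ)) (gradNoise J g) β' σ')
    {κR εR θ : ℝ} (hκR : 0 ≤ κR) (hεR : 0 < εR)
    (hsmooth : ∀ μ ∈ Set.Ioo 0 μmax,
      NoiseCovSmooth P (iterates A η μ g (w₀ μ)) (gradNoise J g) wo κR εR θ)
    {R : Fin N → Matrix (Fin M) (Fin M) ℝ}
    (hR : ∀ μ ∈ Set.Ioo 0 μmax,
      NoiseCovLimit P (iterates A η μ g (w₀ μ)) (gradNoise J g) wo R)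
    {t : ℝ} (ht : 0 < t) (ht1 : t ≤ 1) (htθ : t ≤ θ) :
    ∃ K : ℝ, ∀ᶠ μ in 𝓝[>] (0 : ℝ),
      (∀ i k, MemLp (fun ω => iterates A η μ g (w₀ μ) i ω k) 2 P) ∧
      Summable (traceTerm A J wo R η μ) ∧ ‖linOp A J wo η μ‖ < 1 ∧
      ∀ᶠ i in atTop, |meanSquareError P wo (iterates A η μ g (w₀ μ)) i
        - ∑' n, traceTerm A J wo R η μ n| ≤ K * μ ^ (1 + t / 2) := by
  have hne : Nonempty (Fin N) := hA.connected.nonempty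
  obtain ⟨k₀, hk₀⟩ := Finite.exists_min lmin
  have hl : 0 < lmin k₀ := (hJ k₀).pos
  -- The contraction rate is half of the smallest modulus of strong convexity.
  set c := lmin k₀ / 2 with hc
  have hc0 : 0 < c := by positivity
  set Λ := ∑ k, |lmax k| with hΛ
  have hΛ0 : 0 ≤ Λ := Finset.sum_nonneg fun _ _ => abs_nonneg _
  have hΛk : ∀ k, lmax k ≤ Λ := fun k => (le_abs_self _).trans
    (Finset.single_le_sum (f := fun k => |lmax k|) (fun _ _ => abs_nonneg _) (Finset.mem_univ k))
  have hopt := gradStack_add_lapOp_eq_zero hA.symm hJ hwo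
  set b := ‖η • lapOp M A (gradStack J wo)‖ with hb
  set K₀ := (κH + 2 * Λ / εH) + N * ∑ k, (β' k ^ 4 * (8 * (‖wo k‖ ^ 4 + 1)) + σ' k ^ 4) with hK₀
  have hK₀' : 0 ≤ K₀ := by
    have : 0 ≤ ∑ k, (β' k ^ 4 * (8 * (‖wo k‖ ^ 4 + 1)) + σ' k ^ 4) :=
      Finset.sum_nonneg fun k _ => by positivity
    positivity
  obtain ⟨K₂, hK₂, μ₂, hμ₂, H⟩ := ErrorRecursion.eventually_integral_sq_le (P := P)
    (ι := NetIdx N M) (b := b) hc0 hK₀'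
  set D := ∑ x : NetIdx N M, ∑ _y : NetIdx N M, (κR * εR ^ (θ - t) * (1 + K₂)
    + (2 * β x.1 ^ 2 + (3 * β x.1 ^ 2 * ‖wo x.1‖ ^ 2 + 2 * σ x.1 ^ 2) / εR ^ 2) * K₂ + 1) with hD
  have hD0 : 0 ≤ D := Finset.sum_nonneg fun x _ => Finset.sum_nonneg fun y _ => by positivity
  refine ⟨K₂ + 2 * (D + 1) / c + 1, ?_⟩
  have hsmall : ∀ a : ℝ, 0 < a → ∀ᶠ μ in 𝓝[>] (0 : ℝ), μ < a := fun a ha =>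
    mem_of_superset (Ioo_mem_nhdsGT ha) fun _ h => h.2
  filter_upwards [self_mem_nhdsWithin, hsmall 1 one_pos, hsmall μmax hμmax, hsmall μ₂ hμ₂,
    hsmall (1 / c) (by positivity), hsmall (lmin k₀ / (Λ ^ 2 + 1)) (by positivity)]
    with μ hμ hμ1 hμm hμ2 hμc hμΛ
  rw [Set.mem_Ioi] at hμ
  have hmem : μ ∈ Set.Ioo 0 μmax := ⟨hμ, hμm⟩
  have hcμ : c * μ ≤ 1 := by
    rw [lt_div_iff₀ hc0] at hμc; linarith
  have hμΛ' : ∀ k, μ * Λ ^ 2 ≤ lmin k := fun k => by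
    rw [lt_div_iff₀ (by positivity)] at hμΛ
    linarith [hk₀ k]
  have hW := memLp_iterates hJ (hw₀' μ) (hnoise4 μ hmem)
  have hm := history_le fun i => measurable_iterates (A := A) (η := η) (μ := μ) hg (hw₀ μ) i
  have hrec := errorRecursion_iterates hA.symm hJ hopt hκH hεH hH hg (hw₀ μ) (hw₀' μ)
    (hcomb μ hmem) (hnoise2 μ hmem) (hnoise4 μ hmem) hΛk hΛ0
    (fun k => by rw [hc]; linarith [hk₀ k]) hμ.le hμΛ' hcμ
  have hterm : ∀ n, traceTerm A J wo R η μ n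
      = ErrorRecursion.powerForm (linOp A J wo η μ) (combOp M A η μ) (blockDiag R) μ n :=
    traceTerm_eq_powerForm hA.symm R μ
  have hsum : Summable (traceTerm A J wo R η μ) := by
    rw [funext hterm]
    exact hrec.summable_powerForm hμ hc0 _
  refine ⟨fun i k => (hW i k).two_of_four, hsum,
    hrec.norm_linear.trans_lt (by linarith [mul_pos hc0 hμ]), ?_⟩
  have hmse : ∀ i, meanSquareError P wo (iterates A η μ g (w₀ μ)) i
      = ∫ ω, ‖stack (wo - iterates A η μ g (w₀ μ) i ω)‖ ^ 2 ∂P := by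
    intro i
    simp_rw [norm_stack_sq]
    rfl
  have hX := H μ _ _ _ _ _ _ hμ hμ2 hrec
  have hpos : 0 < μ ^ (t / 2) := Real.rpow_pos_of_pos hμ _
  have hpos1 : 0 < μ ^ (1 + t / 2) := Real.rpow_pos_of_pos hμ _
  have hsplit : μ ^ (1 + t / 2) = μ * μ ^ (t / 2) := by
    rw [Real.rpow_add hμ, Real.rpow_one]
  have hnoise := eventually_sum_abs_noiseStack_le hm hW (hnoise2 μ hmem) hκR hεR ht ht1 htθ
    (hsmooth μ hmem) (hR μ hmem) hμ hμ1.le (hX.mono fun i hi => hi.1)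
  -- `D + 1` rather than `D`, as the bound has to be positive.
  have hlin := hrec.eventually_integral_sq_linearModel hμ hc0 (blockDiag R)
    (δ := (D + 1) * μ ^ (t / 2)) (by positivity)
    (hnoise.mono fun i hi => hi.trans (mul_le_mul_of_nonneg_right (by linarith) hpos.le))
  have htail := Metric.tendsto_nhds.1 hsum.hasSum.tendsto_sum_nat _ hpos1
  filter_upwards [hX, hlin, htail] with i h1 h2 h3
  rw [Real.dist_eq] at h3
  simp only [← hterm] at h2
  rw [hmse]
  have h4 : μ * √μ ≤ μ ^ (1 + t / 2) := by
    rw [hsplit, Real.sqrt_eq_rpow]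
    exact mul_le_mul_of_nonneg_left
      (Real.rpow_le_rpow_of_exponent_ge hμ hμ1.le (by linarith)) hμ.le
  have h5 : 2 * (μ * ((D + 1) * μ ^ (t / 2)) / c) = 2 * (D + 1) / c * μ ^ (1 + t / 2) := by
    rw [hsplit]; ring
  rw [h5] at h2
  calc _ ≤ K₂ * (μ * √μ) + 2 * (D + 1) / c * μ ^ (1 + t / 2) + μ ^ (1 + t / 2) :=
        (abs_sub_le _ _ _).trans (add_le_add ((abs_sub_le _ _ _).trans (add_le_add h1.2 h2)) h3.le)
    _ ≤ K₂ * μ ^ (1 + t / 2) + 2 * (D + 1) / c * μ ^ (1 + t / 2) + μ ^ (1 + t / 2) := by gcongr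
    _ = _ := by ring

end

theorem lemma5 {Ω : Type*} [MeasurableSpace Ω] (P : Measure Ω) [IsProbabilityMeasure P]
    {N M : ℕ} (A : Matrix (Fin N) (Fin N) ℝ) (hA : IsNetwork A)
    (η : ℝ) (hη : 0 ≤ η)
    -- costs
    (J : Fin N → Param M → ℝ) (lmin lmax : Fin N → ℝ)
    (hJ : ∀ k, StronglyConvexCost (J k) (lmin k) (lmax k))
    -- the regularized solution
    (wo : Fin N → Param M) (hwo : IsMinOn (globalCost A J η) Set.univ wo)
    (κH εH : ℝ) (hκH : 0 ≤ κH) (hεH : 0 < εH)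
    (hH : ∀ k, HessianLipschitzNear (J k) (wo k) κH εH)
    -- the gradient approximations, and for every step-size an initial state
    (g : Fin N → ℕ → Param M → Ω → Param M)
    (hg : ∀ k i, Measurable (fun p : Param M × Ω => g k i p.1 p.2))
    (w₀ : ℝ → Ω → Fin N → Param M) (hw₀ : ∀ μ, Measurable (w₀ μ))
    (hw₀' : ∀ μ k, MemLp (fun ω => w₀ μ ω k) 4 P)
    -- conditions for every step-size in some interval, with constants independent of the step-size
    (μmax : ℝ) (hμmax : 0 < μmax)
    (hcomb : ∀ μ ∈ Set.Ioo 0 μmax, CombinationCondition M A η μ)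
    (β σ β' σ' : Fin N → ℝ)
    (hnoise2 : ∀ μ ∈ Set.Ioo 0 μmax,
      NoiseSecondOrder P (iterates A η μ g (w₀ μ)) (gradNoise J g) β σ)
    (hnoise4 : ∀ μ ∈ Set.Ioo 0 μmax,
      NoiseFourthOrder P (iterates A η μ g (w₀ μ)) (gradNoise J g) β' σ')
    (κR εR θ : ℝ) (hκR : 0 ≤ κR) (hεR : 0 < εR) (hθ : 0 < θ) (hθ' : θ ≤ 4)
    (hsmooth : ∀ μ ∈ Set.Ioo 0 μmax,
      NoiseCovSmooth P (iterates A η μ g (w₀ μ)) (gradNoise J g) wo κR εR θ)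
    (R : Fin N → Matrix (Fin M) (Fin M) ℝ)
    (hR : ∀ μ ∈ Set.Ioo 0 μmax,
      NoiseCovLimit P (iterates A η μ g (w₀ μ)) (gradNoise J g) wo R) :
    -- for small step-sizes all the quantities below are meaningful
    (∀ᶠ μ in 𝓝[>] (0 : ℝ),
      (∀ i k, MemLp (fun ω => iterates A η μ g (w₀ μ) i ω k) 2 P) ∧
      BddAbove (Set.range (meanSquareError P wo (iterates A η μ g (w₀ μ)))) ∧
      Summable (traceTerm A J wo R η μ) ∧
      IsUnit (1 - matF A J wo η μ)) ∧
    ((fun μ : ℝ =>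
        limsup (fun i => 1 / (N : ℝ) * meanSquareError P wo (iterates A η μ g (w₀ μ)) i) atTop
          - 1 / (N : ℝ) * ∑' n, traceTerm A J wo R η μ n)
      =O[𝓝[>] (0 : ℝ)] fun μ => μ ^ (1 + 1 / 2 * min 1 θ)) ∧
    ((fun μ : ℝ =>
        limsup (fun i => 1 / (N : ℝ) * meanSquareError P wo (iterates A η μ g (w₀ μ)) i) atTop
          - 1 / (N : ℝ) * bvecForm A J wo R η μ)
      =O[𝓝[>] (0 : ℝ)] fun μ => μ ^ (1 + 1 / 2 * min 1 θ)) := by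
  obtain ⟨K, hK⟩ := eventually_abs_meanSquareError_sub_le P hA hJ hwo hκH hεH hH hg hw₀ hw₀' hμmax
    hcomb hnoise2 hnoise4 hκR hεR hsmooth hR (lt_min one_pos hθ) (min_le_left 1 θ)
    (min_le_right 1 θ)
  have hmain : (fun μ : ℝ =>
        limsup (fun i => 1 / (N : ℝ) * meanSquareError P wo (iterates A η μ g (w₀ μ)) i) atTop
          - 1 / (N : ℝ) * ∑' n, traceTerm A J wo R η μ n)
      =O[𝓝[>] (0 : ℝ)] fun μ => μ ^ (1 + 1 / 2 * min 1 θ) := by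
    refine IsBigO.of_bound (1 / (N : ℝ) * K) ?_
    filter_upwards [hK, self_mem_nhdsWithin] with μ h hμ
    rw [Real.norm_eq_abs, Real.norm_of_nonneg (Real.rpow_nonneg (le_of_lt hμ) _)]
    refine abs_limsup_sub_le ?_
    filter_upwards [h.2.2.2] with i hi
    rw [← mul_sub, abs_mul, abs_of_nonneg (by positivity : 0 ≤ 1 / (N : ℝ)), mul_assoc,
      one_div_mul_eq_div 2 (min 1 θ)]
    exact mul_le_mul_of_nonneg_left hi (by positivity)
  refine ⟨?_, hmain, ?_⟩
  · filter_upwards [hK] with μ h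
    refine ⟨h.1, bddAbove_range_of_eventually_le (r := ∑' n, traceTerm A J wo R η μ n
      + K * μ ^ (1 + min 1 θ / 2)) ?_, h.2.1, isUnit_one_sub_matF h.2.2.1⟩
    filter_upwards [h.2.2.2] with i hi
    linarith [(abs_le.1 hi).2]
  · refine hmain.congr' ?_ EventuallyEq.rfl
    filter_upwards [hK] with μ h
    rw [bvecForm_eq_tsum h.2.2.1 R h.2.1]
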